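/- \textbf{Setting.} Let $X_1,X_2,\dots$ be i.i.d.\ real random variables with law $P^\ast$, a non-degenerate probability distribution supported on $[0,1]$, with mean $\mu^\ast\in(0,1)$ and variance $\sigma^2>0$. Let $\pi$ be a prior probability distribution on $[0,1]$ that is absolutely continuous with respect to Lebesgue measure, with density bounded below by a positive constant almost everywhere in a neighbourhood of $\mu^\ast$. Let $\tau_n\ge 0$ be real numbers with $\tau_n=o(n)$ (in particular $\tau_n=0$ is allowed). For each $\mu\in(0,1)$ let $\mathbb H_\mu$ be a probability distribution supported on $[0,1]$, depending measurably on $\mu$, with $\operatorname{conv}(\operatorname{supp}\mathbb H_\mu)=[0,1]$. \textbf{Construction.} Let $\mathbb P_n=\frac1n\sum_{i=1}^n\delta_{X_i}$ and, for $\mu\in(0,1)$, \[ \mathbb P_{n,\mu}=\tfrac{n}{n+\tau_n}\mathbb P_n+\tfrac{\tau_n}{n+\tau_n}\mathbb H_\mu,\qquad \widetilde{\mathbb P}_{n,\mu}=\operatorname*{arg\,min}_{P\ll\mathbb P_{n,\mu}}\Bigl\{\mathrm{KL}(P\,\|\,\mathbb P_{n,\mu}):\ P\text{ a probability measure},\ \int(z-\mu)\,dP(z)=0\Bigr\}.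 \] Let $\psi_{n,\mu}(\gamma)=\log\int e^{\gamma(z-\mu)}\,d\mathbb P_{n,\mu}(z)$ and let $\gamma_{n,\mu}$ be the solution of $\psi_{n,\mu}'(\gamma)=0$. Set \[ Z_{n,\mu}=\sum_{j=1}^n e^{\gamma_{n,\mu}(X_j-\mu)}+\tau_n\int e^{\gamma_{n,\mu}(z-\mu)}\,d\mathbb H_\mu(z),\qquad w_{n,i}(\mu)=\frac{e^{\gamma_{n,\mu}(X_i-\mu)}}{Z_{n,\mu}},\qquad L_n(\mu)=\prod_{i=1}^n w_{n,i}(\mu), \] except that, when $\tau_n=0$, $L_n(\mu)$ is set to $0$ for every $\mu$ outside the interior of the convex hull of $\{X_1,\dots,X_n\}$. (Arbitrary values are used for $\widetilde{\mathbb P}_{n,\mu}$ and $\gamma_{n,\mu}$ where they do not exist; $L_n$ vanishes at such $\mu\in(0,1)$ for $n\ge1$.) The (B/R)ETEL pseudo-posterior and pseudo-predictive are \[ \Pi_n(d\mu)=\frac{L_n(\mu)\,\pi(d\mu)}{\int_0^1L_n(u)\,\pi(du)},\qquad \mathbb Q_{n+1\mid n}(A\mid X_{1:n})=\int_0^1\widetilde{\mathbb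 P}_{n,\mu}(A)\,\Pi_n(d\mu). \] \textbf{Proposition (consistency of the RETEL predictive).} With probability tending to one, $\Pi_n$ is a well-defined probability measure, and, for every $\epsilon>0$, \[ \Pi_n\bigl(|\mu-\mu^\ast|>\epsilon\bigr)\to0\qquad\text{and}\qquad \Pi_n\bigl(|\gamma_{n,\mu}|>\epsilon\bigr)\to0 \] in probability as $n\to\infty$. Moreover $\mathcal W_1\bigl(\mathbb Q_{n+1\mid n}(\cdot\mid X_{1:n}),P^\ast\bigr)\to0$ in probability, where $\mathcal W_1(P,Q)=\inf_\rho\int|x-y|\,d\rho(x,y)$, the infimum being over all couplings $\rho$ of $P$ and $Q$, is the Wasserstein-1 distance. -/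

import Mathlib

open MeasureTheory ProbabilityTheory Filter Topology Asymptotics
open scoped ENNReal

namespace RETEL

noncomputable section

/-- The Wasserstein-1 distance on the real line: the infimum of `∫ |x - y| dρ(x, y)` over all
couplings `ρ` of `μ` and `ν`. It is `∞` if there is no coupling. -/
def wasserstein1 (μ ν : Measure ℝ) : ℝ≥0∞ :=
  ⨅ (ρ : Measure (ℝ × ℝ)) (_ : ρ.fst = μ ∧ ρ.snd = ν), ∫⁻ p, edist p.1 p.2 ∂ρ

/-- Convergence to zero in `P`-probability of `[0, ∞]`-valued quantities `Y n`. -/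
def TendstoZeroInProb {Ω : Type*} [MeasurableSpace Ω] (P : Measure Ω) (Y : ℕ → Ω → ℝ≥0∞) : Prop :=
  ∀ δ : ℝ≥0∞, 0 < δ → Tendsto (fun n => P {ω | δ ≤ Y n ω}) atTop (𝓝 0)

/-! Throughout, `x 0, …, x (n - 1)` are the first `n` observations, `t ≥ 0` is the weight of the
regulariser, `H m` is the regularising distribution attached to the candidate mean `m`. -/

/-- The empirical distribution `n⁻¹ ∑ δ_{x i}`. -/
def empirical (n : ℕ) (x : ℕ → ℝ) : Measure ℝ :=
  (n : ℝ≥0∞)⁻¹ • ∑ i ∈ Finset.range n, Measure.dirac (x i)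

/-- The regularised empirical distribution
`n / (n + t) • empirical + t / (n + t) • H m`. -/
def base (n : ℕ) (x : ℕ → ℝ) (t : ℝ) (H : ℝ → Measure ℝ) (m : ℝ) : Measure ℝ :=
  ENNReal.ofReal (n / (n + t)) • empirical n x + ENNReal.ofReal (t / (n + t)) • H m

/-- Competitors of the projection: the probability measures `Q ≪ B` with `∫ (z - m) dQ(z) = 0`. -/
def IsFeasible (B : Measure ℝ) (m : ℝ) (Q : Measure ℝ) : Prop :=
  IsProbabilityMeasure Q ∧ Q ≪ B ∧ Integrable (fun z => z - m) Q ∧ ∫ z, (z - m) ∂Q = 0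

/-- `Q` minimises the Kullback-Leibler divergence to `B` among the competitors. -/
def IsKLProjection (B : Measure ℝ) (m : ℝ) (Q : Measure ℝ) : Prop :=
  IsFeasible B m Q ∧
    ∀ Q', IsFeasible B m Q' → InformationTheory.klDiv Q B ≤ InformationTheory.klDiv Q' B

open Classical in
/-- The fitted distribution: the KL projection of the regularised empirical distribution
on the distributions with mean `m` (and `0` if there is none). -/
def fitted (n : ℕ) (x : ℕ → ℝ) (t : ℝ) (H : ℝ → Measure ℝ) (m : ℝ) : Measure ℝ :=
  if h : ∃ Q, IsKLProjection (base n x t H m) m Q then h.choose else 0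

/-- `ψ(γ) = log ∫ exp (γ (z - m)) d(base)(z)`. -/
def psi (n : ℕ) (x : ℕ → ℝ) (t : ℝ) (H : ℝ → Measure ℝ) (m : ℝ) (γ : ℝ) : ℝ :=
  Real.log (∫ z, Real.exp (γ * (z - m)) ∂(base n x t H m))

open Classical in
/-- The tilting parameter: the solution `γ` of `ψ'(γ) = 0` (and `0` if there is none). -/
def tilt (n : ℕ) (x : ℕ → ℝ) (t : ℝ) (H : ℝ → Measure ℝ) (m : ℝ) : ℝ :=
  if h : ∃ γ : ℝ, HasDerivAt (psi n x t H m) 0 γ then h.choose else 0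

/-- The normaliser `Z` of the empirical-likelihood weights. -/
def weightZ (n : ℕ) (x : ℕ → ℝ) (t : ℝ) (H : ℝ → Measure ℝ) (m : ℝ) : ℝ :=
  ∑ j ∈ Finset.range n, Real.exp (tilt n x t H m * (x j - m)) +
    t * ∫ z, Real.exp (tilt n x t H m * (z - m)) ∂(H m)

/-- The empirical-likelihood weight of the `i`-th observation. -/
def weight (n : ℕ) (x : ℕ → ℝ) (t : ℝ) (H : ℝ → Measure ℝ) (m : ℝ) (i : ℕ) : ℝ :=
  Real.exp (tilt n x t H m * (x i - m)) / weightZ n x t H m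

open Classical in
/-- The pseudo-likelihood `∏ i, weight i`; in the unregularised case `t = 0` it is set to zero
outside the interior of the convex hull of the data. -/
def likelihood (n : ℕ) (x : ℕ → ℝ) (t : ℝ) (H : ℝ → Measure ℝ) (m : ℝ) : ℝ :=
  if t = 0 ∧ m ∉ interior (convexHull ℝ (x '' Set.Iio n)) then 0
  else ∏ i ∈ Finset.range n, weight n x t H m i

/-- The pseudo-posterior `likelihood(m) π(dm) / ∫ likelihood dπ`. -/
def posterior (n : ℕ) (x : ℕ → ℝ) (t : ℝ) (H : ℝ → Measure ℝ) (π : Measure ℝ) : Measure ℝ :=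
  (∫⁻ u, ENNReal.ofReal (likelihood n x t H u) ∂π)⁻¹ •
    π.withDensity (fun m => ENNReal.ofReal (likelihood n x t H m))

/-- The pseudo-predictive `A ↦ ∫ fitted(m)(A) posterior(dm)`. -/
def predictive (n : ℕ) (x : ℕ → ℝ) (t : ℝ) (H : ℝ → Measure ℝ) (π : Measure ℝ) : Measure ℝ :=
  (posterior n x t H π).bind (fitted n x t H)

end

end RETEL

/-! For `m` in (0,1) with mass of the base measure on both sides, the moment function `c ↦ ∫ (z - m)
exp (c (z - m))` is continuous, strictly increasing and changes sign. Its unique root is the tilting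
parameter, and the KL projection is the corresponding exponential tilting. Everything else is
deterministic, on samples whose mean is near `μstar`, whose variance is bounded below and for which
`t / n` is small; the law of large numbers makes such samples likely.

Concentration. With `c` the tilt, `M` the sample mean and `Z` the normaliser, the likelihood is the
`n`-th power of `exp (c (M - m)) / Z`. If `m` is far from `M`, then `|c|` is bounded below
(`le_abs_tilt`), and a second-order lower bound for the exponential about `M` makes the likelihood
at most `(1 / (n q)) ^ n` with `q > 1` (`likelihood_le_of_far`). If `m` is near, the tilt is small
(`abs_tilt_le_of_near`) and the tilted mass is at most one, so the likelihood is at least `(exp (-s)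
/ (n + t)) ^ n` (`le_likelihood`). As the prior charges every ball around `μstar`, the posterior
mass of the far set decays geometrically (`exists_posterior_le`). Concentration of the tilt follows,
since it is small for `m` near `μstar`.

Prediction. A small tilt keeps the density of the fitted law relative to the base measure close to
at least one. Integrating over the posterior, the predictive retains almost all the `Pstar`-mass of
every cell of a fine partition, and an explicit coupling turns this into a Wasserstein bound
(`wasserstein1_le_of_partition`). -/

namespace RETEL

/-! ### Exponential tilting and the KL projection -/

section Tilting

variable {B : Measure ℝ} {m c : ℝ}

lemma integrable_of_continuous [IsFiniteMeasure B] (hB : B (Set.Icc 0 1)ᶜ = 0) {f : ℝ → ℝ}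
    (hf : Continuous f) : Integrable f B := by
  have h : B.restrict (Set.Icc 0 1) = B :=
    Measure.restrict_eq_self_of_ae_mem (mem_ae_iff.2 hB)
  rw [← h]
  exact hf.continuousOn.integrableOn_compact isCompact_Icc

lemma ae_mem_Icc (hB : B (Set.Icc 0 1)ᶜ = 0) : ∀ᵐ z ∂B, z ∈ Set.Icc (0 : ℝ) 1 :=
  mem_ae_iff.2 hB

/-- The first moment about `m` of the measure `exp (c (z - m)) dB(z)`. -/
noncomputable def tiltMoment (B : Measure ℝ) (m c : ℝ) : ℝ :=
  ∫ z, (z - m) * Real.exp (c * (z - m)) ∂B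

/-- The mass of the measure `exp (c (z - m)) dB(z)`. -/
noncomputable def tiltMass (B : Measure ℝ) (m c : ℝ) : ℝ :=
  ∫ z, Real.exp (c * (z - m)) ∂B

lemma mem_interior_integrableExpSet [IsFiniteMeasure B] (hB : B (Set.Icc 0 1)ᶜ = 0) (m c : ℝ) :
    c ∈ interior (integrableExpSet (fun z => z - m) B) := by
  have : integrableExpSet (fun z => z - m) B = Set.univ :=
    Set.eq_univ_of_forall fun c => integrable_of_continuous hB (by fun_prop)
  simp [this]

lemma tiltMass_pos [IsProbabilityMeasure B] (hB : B (Set.Icc 0 1)ᶜ = 0) (m c : ℝ) :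
    0 < tiltMass B m c :=
  integral_exp_pos (integrable_of_continuous hB (by fun_prop))

lemma hasDerivAt_log_tiltMass [IsProbabilityMeasure B] (hB : B (Set.Icc 0 1)ᶜ = 0) (m c : ℝ) :
    HasDerivAt (fun c => Real.log (tiltMass B m c)) (tiltMoment B m c / tiltMass B m c) c :=
  (hasDerivAt_mgf (mem_interior_integrableExpSet hB m c)).log (tiltMass_pos hB m c).ne'

lemma continuous_tiltMoment [IsFiniteMeasure B] (hB : B (Set.Icc 0 1)ᶜ = 0) (m : ℝ) :
    Continuous (tiltMoment B m) := by
  have h (c : ℝ) := hasDerivAt_integral_pow_mul_exp_real (mem_interior_integrableExpSet hB m c) 1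
  simp only [pow_one] at h
  exact continuous_iff_continuousAt.2 fun c => (h c).continuousAt

lemma mul_exp_mono {y a b : ℝ} (hab : a ≤ b) : y * Real.exp (a * y) ≤ y * Real.exp (b * y) := by
  rcases le_total 0 y with hy | hy
  · exact mul_le_mul_of_nonneg_left (Real.exp_le_exp.2 (by nlinarith)) hy
  · exact mul_le_mul_of_nonpos_left (Real.exp_le_exp.2 (by nlinarith)) hy

lemma mul_exp_strictMono {y a b : ℝ} (hy : y ≠ 0) (hab : a < b) :
    y * Real.exp (a * y) < y * Real.exp (b * y) := by
  rcases hy.lt_or_gt with hy | hy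
  · exact mul_lt_mul_of_neg_left (Real.exp_lt_exp.2 (by nlinarith)) hy
  · exact mul_lt_mul_of_pos_left (Real.exp_lt_exp.2 (by nlinarith)) hy

lemma integrable_mul_exp [IsFiniteMeasure B] (hB : B (Set.Icc 0 1)ᶜ = 0) (m c : ℝ) :
    Integrable (fun z => (z - m) * Real.exp (c * (z - m))) B :=
  integrable_of_continuous hB (by fun_prop)

lemma integrable_exp [IsFiniteMeasure B] (hB : B (Set.Icc 0 1)ᶜ = 0) (m c : ℝ) :
    Integrable (fun z => Real.exp (c * (z - m))) B :=
  integrable_of_continuous hB (by fun_prop)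

lemma monotone_tiltMoment [IsFiniteMeasure B] (hB : B (Set.Icc 0 1)ᶜ = 0) (m : ℝ) :
    Monotone (tiltMoment B m) := fun a b hab =>
  integral_mono (integrable_mul_exp hB m a) (integrable_mul_exp hB m b) fun _ => mul_exp_mono hab

/-- The integrand increases strictly with the parameter except at `z = m`, so equality of two
moments would force all the mass onto `m`. Mass on one side suffices here; existence of a root needs
both. -/
lemma strictMono_tiltMoment [IsFiniteMeasure B] (hB : B (Set.Icc 0 1)ᶜ = 0)
    (hpos : B (Set.Ioi m) ≠ 0) : StrictMono (tiltMoment B m) := by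
  refine fun a b hab => (monotone_tiltMoment hB m hab.le).lt_of_ne fun h => hpos ?_
  have h0 : ∫ z, ((z - m) * Real.exp (b * (z - m)) - (z - m) * Real.exp (a * (z - m))) ∂B = 0 := by
    rw [integral_sub (integrable_mul_exp hB m b) (integrable_mul_exp hB m a)]
    exact sub_eq_zero.2 h.symm
  rw [integral_eq_zero_iff_of_nonneg (fun z => sub_nonneg.2 (mul_exp_mono hab.le))
    ((integrable_mul_exp hB m b).sub (integrable_mul_exp hB m a))] at h0
  refine measure_mono_null (fun z hz => ?_) (mem_ae_iff.1 h0)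
  simp only [Set.mem_compl_iff, Set.mem_ofPred_eq, Pi.zero_apply]
  exact (sub_pos.2 (mul_exp_strictMono (sub_ne_zero.2 (Set.mem_Ioi.1 hz).ne') hab)).ne'

lemma exists_pos_measure_of_measure_Ioi_ne_zero (h : B (Set.Ioi m) ≠ 0) :
    ∃ δ > 0, B (Set.Ici (m + δ)) ≠ 0 := by
  by_contra! hc
  refine h (measure_mono_null (t := ⋃ k : ℕ, Set.Ici (m + 1 / ((k : ℝ) + 1))) (fun z hz => ?_)
    (measure_iUnion_null fun k => hc _ Nat.one_div_pos_of_nat))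
  obtain ⟨k, hk⟩ := exists_nat_one_div_lt (sub_pos.2 (Set.mem_Ioi.1 hz))
  exact Set.mem_iUnion.2 ⟨k, by simp only [Set.mem_Ici]; linarith⟩

lemma exists_tiltMoment_pos [IsFiniteMeasure B] (hB : B (Set.Icc 0 1)ᶜ = 0)
    (hm : m ∈ Set.Icc (0 : ℝ) 1) (h : B (Set.Ioi m) ≠ 0) : ∃ c, 0 < tiltMoment B m c := by
  obtain ⟨δ, hδ, hδB⟩ := exists_pos_measure_of_measure_Ioi_ne_zero h
  set p := B.real (Set.Ici (m + δ))
  set q := B.real Set.univ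
  have hp : 0 < p := ENNReal.toReal_pos hδB (measure_ne_top _ _)
  have hq : 0 ≤ q := measureReal_nonneg
  -- The integrand is at least `c δ²` on `[m + δ, ∞)`, up to the loss of at most `1` allowed
  -- everywhere. This `c` makes the gain `q + 1` against a total loss `q`.
  refine ⟨(q + 1) / (δ * δ * p), ?_⟩
  set c := (q + 1) / (δ * δ * p) with hc
  have hc0 : 0 ≤ c := by positivity
  have key : ∫ z, ((Set.Ici (m + δ)).indicator (fun _ => c * δ * δ) z - 1) ∂B ≤
      tiltMoment B m c := by
    refine integral_mono_ae ((integrable_const _).indicator measurableSet_Ici |>.sub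
      (integrable_const _)) (integrable_mul_exp hB m c) ?_
    filter_upwards [ae_mem_Icc hB] with z hz
    by_cases hzm : m + δ ≤ z
    · rw [Set.indicator_of_mem (show z ∈ Set.Ici (m + δ) from hzm)]
      have h1 : c * (z - m) + 1 ≤ Real.exp (c * (z - m)) := Real.add_one_le_exp _
      have h2 : δ ≤ z - m := by linarith
      have h3 : c * δ ≤ c * (z - m) := mul_le_mul_of_nonneg_left h2 hc0
      have h4 : δ * (c * δ) ≤ (z - m) * Real.exp (c * (z - m)) :=
        mul_le_mul h2 (by linarith) (by positivity) (by linarith)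
      linarith
    · rw [Set.indicator_of_notMem (show z ∉ Set.Ici (m + δ) from hzm), zero_sub]
      rcases le_total 0 (z - m) with h0 | h0
      · have := mul_nonneg h0 (Real.exp_pos (c * (z - m))).le
        linarith
      · have h1 : Real.exp (c * (z - m)) ≤ 1 :=
          Real.exp_le_one_iff.2 (mul_nonpos_of_nonneg_of_nonpos hc0 h0)
        have h2 := Real.exp_pos (c * (z - m))
        have h3 : -1 ≤ z - m := by linarith [hz.1, hm.2]
        nlinarith
  rw [integral_sub ((integrable_const _).indicator measurableSet_Ici) (integrable_const _),
    integral_indicator measurableSet_Ici, setIntegral_const, integral_const] at key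
  simp only [smul_eq_mul, mul_one] at key
  have : p * (c * δ * δ) = q + 1 := by rw [hc]; field_simp
  have h5 : p * (c * δ * δ) - q ≤ tiltMoment B m c := key
  linarith

lemma exists_tiltMoment_neg [IsFiniteMeasure B] (hB : B (Set.Icc 0 1)ᶜ = 0)
    (hm : m ∈ Set.Icc (0 : ℝ) 1) (h : B (Set.Iio m) ≠ 0) : ∃ c, tiltMoment B m c < 0 := by
  -- The reflection `z ↦ 1 - z` preserves the unit interval and reduces to the positive case.
  have hr : Measurable fun z : ℝ => 1 - z := by fun_prop
  have hB' : B.map (fun z => 1 - z) (Set.Icc 0 1)ᶜ = 0 := by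
    rw [Measure.map_apply hr measurableSet_Icc.compl]
    refine measure_mono_null (t := (Set.Icc 0 1)ᶜ) (fun z hz hz' => hz ?_) hB
    exact ⟨by linarith [hz'.2], by linarith [hz'.1]⟩
  have h' : B.map (fun z => 1 - z) (Set.Ioi (1 - m)) ≠ 0 := by
    rw [Measure.map_apply hr measurableSet_Ioi]
    convert h using 2
    ext z; simp
  have : IsFiniteMeasure (B.map fun z => 1 - z) := by infer_instance
  obtain ⟨c, hc⟩ := exists_tiltMoment_pos hB' (m := 1 - m)
    ⟨by linarith [hm.2], by linarith [hm.1]⟩ h'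
  refine ⟨-c, ?_⟩
  rw [tiltMoment, integral_map hr.aemeasurable (by fun_prop)] at hc
  have : tiltMoment B m (-c) =
      -∫ z, (1 - z - (1 - m)) * Real.exp (c * (1 - z - (1 - m))) ∂B := by
    rw [tiltMoment, ← integral_neg]
    congr 1; ext z
    rw [show -c * (z - m) = c * (1 - z - (1 - m)) by ring]; ring
  linarith

lemma exists_tiltMoment_eq_zero [IsFiniteMeasure B] (hB : B (Set.Icc 0 1)ᶜ = 0)
    (hm : m ∈ Set.Icc (0 : ℝ) 1) (h : B (Set.Iio m) ≠ 0) (h' : B (Set.Ioi m) ≠ 0) :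
    ∃ c, tiltMoment B m c = 0 := by
  obtain ⟨a, ha⟩ := exists_tiltMoment_neg hB hm h
  obtain ⟨b, hb⟩ := exists_tiltMoment_pos hB hm h'
  exact mem_range_of_exists_le_of_exists_ge (continuous_tiltMoment hB m) ⟨a, ha.le⟩ ⟨b, hb.le⟩

/-- The root minimises the convex function `tiltMass B m`, whose value at `0` is one. Concretely,
`exp u - u exp u ≤ 1` is integrated and the moment term vanishes. -/
lemma tiltMass_le_one [IsProbabilityMeasure B] (hB : B (Set.Icc 0 1)ᶜ = 0)
    (hc : tiltMoment B m c = 0) : tiltMass B m c ≤ 1 := by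
  have h : ∫ z, (Real.exp (c * (z - m)) - c * ((z - m) * Real.exp (c * (z - m)))) ∂B ≤
      ∫ _, (1 : ℝ) ∂B := by
    refine integral_mono ((integrable_exp hB m c).sub ((integrable_mul_exp hB m c).const_mul c))
      (integrable_const _) fun z => ?_
    have h1 := Real.add_one_le_exp (-(c * (z - m)))
    have h2 : Real.exp (-(c * (z - m))) * Real.exp (c * (z - m)) = 1 := by
      rw [← Real.exp_add]; simp
    have h3 := Real.exp_pos (c * (z - m))
    show Real.exp (c * (z - m)) - c * ((z - m) * Real.exp (c * (z - m))) ≤ 1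
    nlinarith
  rw [integral_sub (integrable_exp hB m c) ((integrable_mul_exp hB m c).const_mul c),
    integral_const_mul] at h
  change tiltMass B m c - c * tiltMoment B m c ≤ _ at h
  simpa [hc] using h

/-- The exponential tilting of `B` about `m`. -/
noncomputable def tiltedAt (B : Measure ℝ) (m c : ℝ) : Measure ℝ :=
  B.tilted fun z => c * (z - m)

lemma tiltedAt_compl_Icc (hB : B (Set.Icc 0 1)ᶜ = 0) : tiltedAt B m c (Set.Icc 0 1)ᶜ = 0 :=
  tilted_absolutelyContinuous B _ hB

lemma isProbabilityMeasure_tiltedAt [IsProbabilityMeasure B] (hB : B (Set.Icc 0 1)ᶜ = 0) :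
    IsProbabilityMeasure (tiltedAt B m c) :=
  isProbabilityMeasure_tilted (integrable_exp hB m c)

lemma isFeasible_tiltedAt [IsProbabilityMeasure B] (hB : B (Set.Icc 0 1)ᶜ = 0)
    (hc : tiltMoment B m c = 0) : IsFeasible B m (tiltedAt B m c) := by
  have := isProbabilityMeasure_tiltedAt (m := m) (c := c) hB
  refine ⟨this, tilted_absolutelyContinuous B _,
    integrable_of_continuous (tiltedAt_compl_Icc hB) (by fun_prop), ?_⟩
  rw [tiltedAt, integral_tilted]
  have : (fun z => (Real.exp (c * (z - m)) / ∫ z, Real.exp (c * (z - m)) ∂B) • (z - m)) =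
      fun z => (tiltMass B m c)⁻¹ * ((z - m) * Real.exp (c * (z - m))) := by
    ext z; rw [smul_eq_mul, tiltMass]; ring
  rw [this, integral_const_mul]
  exact mul_eq_zero_of_right _ hc

lemma isFeasible_compl_Icc (hB : B (Set.Icc 0 1)ᶜ = 0) {Q : Measure ℝ} (hQ : IsFeasible B m Q) :
    Q (Set.Icc 0 1)ᶜ = 0 := hQ.2.1 hB

lemma klDiv_tiltedAt [IsProbabilityMeasure B] (hB : B (Set.Icc 0 1)ᶜ = 0)
    (hc : tiltMoment B m c = 0) :
    InformationTheory.klDiv (tiltedAt B m c) B ≠ ∞ ∧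
      (InformationTheory.klDiv (tiltedAt B m c) B).toReal = -Real.log (tiltMass B m c) := by
  have hT := isFeasible_tiltedAt hB hc
  have := hT.1
  have hTi := integrable_of_continuous (tiltedAt_compl_Icc (m := m) (c := c) hB)
    (f := fun z => c * (z - m)) (by fun_prop)
  have hllr : llr (tiltedAt B m c) B =ᵐ[tiltedAt B m c]
      fun z => c * (z - m) - Real.log (tiltMass B m c) :=
    hT.2.1.ae_le (log_rnDeriv_tilted_left_self (integrable_exp hB m c))
  refine ⟨InformationTheory.klDiv_ne_top hT.2.1
    ((integrable_congr hllr).2 (hTi.sub (integrable_const _))), ?_⟩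
  rw [InformationTheory.toReal_klDiv_of_measure_eq hT.2.1 (by simp), integral_congr_ae hllr,
    integral_sub hTi (integrable_const _), integral_const_mul, hT.2.2.2]
  simp

/-- Pythagorean identity: the log-density of the tilting is affine in `z - m`, and its linear part
integrates to zero against any competitor. No root condition on `c` is needed. -/
lemma klDiv_eq_add_of_isFeasible [IsProbabilityMeasure B] (hB : B (Set.Icc 0 1)ᶜ = 0)
    {Q : Measure ℝ} (hQ : IsFeasible B m Q)
    (hQB : InformationTheory.klDiv Q B ≠ ∞) :
    InformationTheory.klDiv Q (tiltedAt B m c) ≠ ∞ ∧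
    (InformationTheory.klDiv Q B).toReal =
      (InformationTheory.klDiv Q (tiltedAt B m c)).toReal - Real.log (tiltMass B m c) := by
  have := isProbabilityMeasure_tiltedAt (m := m) (c := c) hB
  have := hQ.1
  have hQi := integrable_of_continuous (isFeasible_compl_Icc hB hQ)
    (f := fun z => c * (z - m)) (by fun_prop)
  have hllr := (InformationTheory.klDiv_ne_top_iff.1 hQB).2
  have hac : Q ≪ tiltedAt B m c :=
    hQ.2.1.trans (absolutelyContinuous_tilted (integrable_exp hB m c))
  refine ⟨InformationTheory.klDiv_ne_top hac
    (integrable_llr_tilted_right hQ.2.1 hQi hllr (integrable_exp hB m c)), ?_⟩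
  rw [InformationTheory.toReal_klDiv_of_measure_eq hQ.2.1 (by simp),
    InformationTheory.toReal_klDiv_of_measure_eq hac (by simp), tiltedAt,
    integral_llr_tilted_right hQ.2.1 hQi (integrable_exp hB m c) hllr,
    integral_const_mul, hQ.2.2.2, tiltMass]
  ring

/-- By the Pythagorean identity, the excess divergence of a competitor is its divergence from the
tilting, which vanishes only at the tilting. Uniqueness makes the choice in `fitted` harmless. -/
theorem isKLProjection_iff [IsProbabilityMeasure B] (hB : B (Set.Icc 0 1)ᶜ = 0)
    (hc : tiltMoment B m c = 0) {Q : Measure ℝ} :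
    IsKLProjection B m Q ↔ Q = tiltedAt B m c := by
  have hT := isFeasible_tiltedAt hB hc
  obtain ⟨hT1, hT2⟩ := klDiv_tiltedAt hB hc
  have := hT.1
  constructor
  · rintro ⟨hQ, hmin⟩
    have := hQ.1
    have hle := hmin _ hT
    have hQB : InformationTheory.klDiv Q B ≠ ∞ := ne_top_of_le_ne_top hT1 hle
    obtain ⟨h1, h2⟩ := klDiv_eq_add_of_isFeasible (c := c) hB hQ hQB
    have h3 := ENNReal.toReal_mono hT1 hle
    have h4 : (InformationTheory.klDiv Q (tiltedAt B m c)).toReal = 0 :=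
      le_antisymm (by linarith) ENNReal.toReal_nonneg
    exact InformationTheory.klDiv_eq_zero_iff.1
      (((ENNReal.toReal_eq_zero_iff _).1 h4).resolve_right h1)
  · rintro rfl
    refine ⟨hT, fun Q hQ => ?_⟩
    by_cases hQB : InformationTheory.klDiv Q B = ∞
    · simp [hQB]
    obtain ⟨h1, h2⟩ := klDiv_eq_add_of_isFeasible (c := c) hB hQ hQB
    rw [← ENNReal.toReal_le_toReal hT1 hQB, hT2, h2]
    linarith [(ENNReal.toReal_nonneg : 0 ≤ (InformationTheory.klDiv Q (tiltedAt B m c)).toReal)]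

/-- The density has numerator at least `exp (-η)`, because `|z - m| ≤ 1`, and denominator at most
one. -/
lemma ofReal_exp_mul_le_tiltedAt [IsProbabilityMeasure B] (hB : B (Set.Icc 0 1)ᶜ = 0)
    (hm : m ∈ Set.Icc (0 : ℝ) 1) (hc : tiltMoment B m c = 0) {η : ℝ} (hη : |c| ≤ η) {A : Set ℝ}
    (hA : MeasurableSet A) : ENNReal.ofReal (Real.exp (-η)) * B A ≤ tiltedAt B m c A := by
  rw [tiltedAt, tilted_apply' _ _ hA, ← setLIntegral_const]
  refine lintegral_mono_ae ((ae_restrict_of_ae (ae_mem_Icc hB)).mono fun z hz => ?_)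
  refine ENNReal.ofReal_le_ofReal ?_
  change Real.exp (-η) ≤ Real.exp (c * (z - m)) / tiltMass B m c
  rw [le_div_iff₀ (tiltMass_pos hB m c)]
  have h1 : |z - m| ≤ 1 := abs_le.2 ⟨by linarith [hz.1, hm.2], by linarith [hz.2, hm.1]⟩
  have h2 : |c * (z - m)| ≤ η := by
    rw [abs_mul]
    exact (mul_le_of_le_one_right (abs_nonneg c) h1).trans hη
  calc Real.exp (-η) * tiltMass B m c ≤ Real.exp (-η) * 1 :=
        mul_le_mul_of_nonneg_left (tiltMass_le_one hB hc) (Real.exp_pos _).le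
    _ ≤ Real.exp (c * (z - m)) := by
        rw [mul_one]; exact Real.exp_le_exp.2 (abs_le.1 h2).1

end Tilting

/-! ### Second-order bounds for the exponential -/

section Exponential

lemma one_add_add_sq_le_exp {u : ℝ} (hu : |u| ≤ 1) : 1 + u + u ^ 2 / 4 ≤ Real.exp u := by
  have h := (abs_le.1 (Real.exp_bound hu (n := 3) (by norm_num))).1
  simp only [Finset.sum_range_succ, Finset.sum_range_zero] at h
  norm_num [Nat.factorial] at h
  have h3 : |u| ^ 3 ≤ u ^ 2 := by
    rw [← sq_abs u]
    nlinarith [abs_nonneg u, sq_nonneg |u|]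
  linarith [sq_nonneg u]

/-- The tilt has no a priori upper bound, so the Taylor bound cannot be applied at `c * y`. By
convexity `exp u - 1 - u` only decreases when `u` is scaled by `g / |c| ≤ 1`, which brings the
argument into `[-1, 1]`. -/
lemma one_add_add_sq_le_exp_of_le {y g c : ℝ} (hg : 0 ≤ g) (hgc : g ≤ |c|) (hgy : |g * y| ≤ 1) :
    1 + c * y + (g * y) ^ 2 / 4 ≤ Real.exp (c * y) := by
  rcases eq_or_lt_of_le (abs_nonneg c) with h0 | h0
  · have : g = 0 := le_antisymm (h0 ▸ hgc) hg
    have hc : c = 0 := abs_eq_zero.1 h0.symm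
    simp [this, hc]
  set l := g / |c|
  have hl0 : 0 ≤ l := by positivity
  have hl1 : l ≤ 1 := (div_le_one h0).2 hgc
  have hlc : l * |c| = g := div_mul_cancel₀ _ h0.ne'
  have hsq : (l * (c * y)) ^ 2 = (g * y) ^ 2 := by
    rw [← hlc, mul_pow, mul_pow, mul_pow, mul_pow, sq_abs]; ring
  have habs : |l * (c * y)| ≤ 1 := by
    rwa [← sq_le_one_iff_abs_le_one, hsq, sq_le_one_iff_abs_le_one]
  have h1 := one_add_add_sq_le_exp habs
  have h2 := convexOn_exp.2 (Set.mem_univ 0) (Set.mem_univ (c * y)) (sub_nonneg.2 hl1) hl0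
    (by ring)
  simp only [smul_eq_mul, mul_zero, zero_add, Real.exp_zero, mul_one] at h2
  have h3 := Real.add_one_le_exp (c * y)
  rw [hsq] at h1
  nlinarith

lemma add_sq_le_mul_exp {u : ℝ} (hu : |u| ≤ 1) : u + u ^ 2 / 2 ≤ u * Real.exp u := by
  obtain ⟨h1, h2⟩ := abs_le.1 hu
  rcases le_total 0 u with h | h
  · nlinarith [Real.add_one_le_exp u]
  · have h3 := Real.add_one_le_exp (-u)
    have h4 : Real.exp (-u) * Real.exp u = 1 := by rw [← Real.exp_add]; simp
    have h5 := Real.exp_pos u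
    have h6 : Real.exp u * (1 - u) ≤ 1 := by nlinarith
    have h7 : Real.exp u ≤ 1 + u / 2 := by
      by_contra! hc
      nlinarith
    nlinarith

end Exponential

/-! ### Deterministic bounds for the tilt and the likelihood -/

/-- The regularity of a sample and of the regularising distributions. -/
structure Admissible (n : ℕ) (x : ℕ → ℝ) (t : ℝ) (H : ℝ → Measure ℝ) : Prop where
  pos : 0 < n
  mem : ∀ i ∈ Finset.range n, x i ∈ Set.Icc (0 : ℝ) 1
  nonneg : 0 ≤ t
  prob : ∀ m ∈ Set.Ioo (0 : ℝ) 1, IsProbabilityMeasure (H m)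
  supp : ∀ m ∈ Set.Ioo (0 : ℝ) 1, H m (Set.Icc 0 1)ᶜ = 0
  conv : ∀ m ∈ Set.Ioo (0 : ℝ) 1, convexHull ℝ (H m).support = Set.Icc 0 1

/-- The sample average of `f`. -/
noncomputable def average (n : ℕ) (x : ℕ → ℝ) (f : ℝ → ℝ) : ℝ := (∑ i ∈ Finset.range n, f (x i)) / n

/-- The candidate means at which the pseudo-likelihood is not set to zero. -/
def IsInner (n : ℕ) (x : ℕ → ℝ) (t m : ℝ) : Prop :=
  t ≠ 0 ∨ m ∈ interior (convexHull ℝ (x '' Set.Iio n))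

section Base

variable {n : ℕ} {x : ℕ → ℝ} {t : ℝ} {H : ℝ → Measure ℝ} {m : ℝ}

lemma empirical_apply {A : Set ℝ} :
    empirical n x A = (n : ℝ≥0∞)⁻¹ * ∑ i ∈ Finset.range n, Measure.dirac (x i) A := by
  simp [empirical]

namespace Admissible

variable (h : Admissible n x t H)
include h

lemma cast_pos : (0 : ℝ) < n := Nat.cast_pos.2 h.pos

lemma add_pos : (0 : ℝ) < n + t := add_pos_of_pos_of_nonneg h.cast_pos h.nonneg

lemma isProbabilityMeasure_empirical : IsProbabilityMeasure (empirical n x) := by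
  refine ⟨?_⟩
  rw [empirical_apply]
  simp [ENNReal.inv_mul_cancel (Nat.cast_ne_zero.2 h.pos.ne') (ENNReal.natCast_ne_top n)]

lemma empirical_compl_Icc : empirical n x (Set.Icc 0 1)ᶜ = 0 := by
  rw [empirical_apply, Finset.sum_eq_zero, mul_zero]
  intro i hi
  rw [Measure.dirac_apply' _ measurableSet_Icc.compl, Set.indicator_of_notMem]
  exact fun hc => hc (h.mem i hi)

lemma isProbabilityMeasure_base (hm : m ∈ Set.Ioo (0 : ℝ) 1) :
    IsProbabilityMeasure (base n x t H m) := by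
  have := h.isProbabilityMeasure_empirical
  have := h.prob m hm
  refine ⟨?_⟩
  simp only [base, Measure.add_apply, Measure.smul_apply, measure_univ, smul_eq_mul, mul_one]
  have h1 := h.add_pos
  rw [← ENNReal.ofReal_add (by positivity) (div_nonneg h.nonneg h1.le), ← add_div,
    div_self h1.ne', ENNReal.ofReal_one]

lemma base_compl_Icc (hm : m ∈ Set.Ioo (0 : ℝ) 1) : base n x t H m (Set.Icc 0 1)ᶜ = 0 := by
  simp [base, h.empirical_compl_Icc, h.supp m hm]

lemma integral_base (hm : m ∈ Set.Ioo (0 : ℝ) 1) {f : ℝ → ℝ} (hf : Continuous f) :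
    ∫ z, f z ∂base n x t H m =
      (∑ i ∈ Finset.range n, f (x i) + t * ∫ z, f z ∂H m) / (n + t) := by
  have := h.isProbabilityMeasure_empirical
  have := h.prob m hm
  have h1 := h.add_pos
  have h2 := h.cast_pos
  have hE : ∫ z, f z ∂empirical n x = (n : ℝ)⁻¹ * ∑ i ∈ Finset.range n, f (x i) := by
    rw [empirical, integral_smul_measure, integral_finsetSum_measure
      fun i _ => integrable_dirac (by simp)]
    simp
  rw [base, integral_add_measure
    ((integrable_of_continuous h.empirical_compl_Icc hf).smul_measure ENNReal.ofReal_ne_top)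
    ((integrable_of_continuous (h.supp m hm) hf).smul_measure ENNReal.ofReal_ne_top),
    integral_smul_measure, integral_smul_measure, hE,
    ENNReal.toReal_ofReal (by positivity), ENNReal.toReal_ofReal (div_nonneg h.nonneg h1.le)]
  simp only [smul_eq_mul]
  field_simp

lemma hasDerivAt_psi_iff (hm : m ∈ Set.Ioo (0 : ℝ) 1) {c : ℝ} :
    HasDerivAt (psi n x t H m) 0 c ↔ tiltMoment (base n x t H m) m c = 0 := by
  have := h.isProbabilityMeasure_base hm
  have hd := hasDerivAt_log_tiltMass (h.base_compl_Icc hm) m c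
  have hM := tiltMass_pos (h.base_compl_Icc hm) m c
  change HasDerivAt (psi n x t H m) _ c at hd
  constructor
  · intro h0
    exact (div_eq_zero_iff.1 (hd.unique h0)).resolve_right hM.ne'
  · intro h0
    simpa [h0] using hd

/-- Otherwise the support, hence its convex hull, would lie in `Set.Iic m` and miss `1`. -/
lemma measure_H_Ioi_ne_zero (hm : m ∈ Set.Ioo (0 : ℝ) 1) : H m (Set.Ioi m) ≠ 0 := by
  intro h0
  have h1 : (H m).support ⊆ Set.Iic m := by
    refine Measure.support_subset_of_isClosed isClosed_Iic (mem_ae_iff.2 ?_)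
    rwa [Set.compl_Iic]
  have h2 := convexHull_min (𝕜 := ℝ) h1 (convex_Iic m)
  rw [h.conv m hm] at h2
  exact absurd (h2 (Set.right_mem_Icc.2 zero_le_one)) (not_le.2 hm.2)

lemma measure_H_Iio_ne_zero (hm : m ∈ Set.Ioo (0 : ℝ) 1) : H m (Set.Iio m) ≠ 0 := by
  intro h0
  have h1 : (H m).support ⊆ Set.Ici m := by
    refine Measure.support_subset_of_isClosed isClosed_Ici (mem_ae_iff.2 ?_)
    rwa [Set.compl_Ici]
  have h2 := convexHull_min (𝕜 := ℝ) h1 (convex_Ici m)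
  rw [h.conv m hm] at h2
  exact absurd (h2 (Set.left_mem_Icc.2 zero_le_one)) (not_le.2 hm.1)

omit h in
lemma ofReal_mul_empirical_le_base (m : ℝ) (A : Set ℝ) :
    ENNReal.ofReal (n / (n + t)) * empirical n x A ≤ base n x t H m A := by
  simp [base]

lemma base_ne_zero_of_sample {A : Set ℝ} {i : ℕ} (hi : i < n) (hA : x i ∈ A) :
    base n x t H m A ≠ 0 := by
  refine (lt_of_lt_of_le ?_ (ofReal_mul_empirical_le_base m A)).ne'
  refine ENNReal.mul_pos (ENNReal.ofReal_pos.2 (div_pos h.cast_pos h.add_pos)).ne' ?_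
  rw [empirical_apply]
  refine mul_ne_zero (ENNReal.inv_ne_zero.2 (ENNReal.natCast_ne_top n)) fun h0 => ?_
  have := Finset.sum_eq_zero_iff.1 h0 i (Finset.mem_range.2 hi)
  rw [Measure.dirac_apply_of_mem hA] at this
  exact one_ne_zero this

lemma base_ne_zero_of_reg (ht : t ≠ 0) {A : Set ℝ} (hA : H m A ≠ 0) :
    base n x t H m A ≠ 0 := by
  simp only [base, Measure.add_apply, Measure.smul_apply, smul_eq_mul, ne_eq, add_eq_zero,
    not_and_or]
  exact Or.inr (mul_ne_zero
    (ENNReal.ofReal_pos.2 (div_pos (lt_of_le_of_ne h.nonneg ht.symm) h.add_pos)).ne' hA)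

lemma base_Ioi_ne_zero (hm : m ∈ Set.Ioo (0 : ℝ) 1) (hi : IsInner n x t m) :
    base n x t H m (Set.Ioi m) ≠ 0 := by
  rcases hi with ht | hi
  · exact h.base_ne_zero_of_reg ht (h.measure_H_Ioi_ne_zero hm)
  · by_contra! hc
    have h1 : x '' Set.Iio n ⊆ Set.Iic m := by
      rintro _ ⟨i, hin, rfl⟩
      by_contra! h2
      exact h.base_ne_zero_of_sample hin (not_le.1 h2) hc
    have h2 := interior_mono (convexHull_min h1 (convex_Iic m)) hi
    simp at h2

lemma base_Iio_ne_zero (hm : m ∈ Set.Ioo (0 : ℝ) 1) (hi : IsInner n x t m) :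
    base n x t H m (Set.Iio m) ≠ 0 := by
  rcases hi with ht | hi
  · exact h.base_ne_zero_of_reg ht (h.measure_H_Iio_ne_zero hm)
  · by_contra! hc
    have h1 : x '' Set.Iio n ⊆ Set.Ici m := by
      rintro _ ⟨i, hin, rfl⟩
      by_contra! h2
      exact h.base_ne_zero_of_sample (A := Set.Iio m) hin (by simpa using h2) hc
    have h2 := interior_mono (convexHull_min h1 (convex_Ici m)) hi
    simp at h2

/-- At inner `m` a root exists, so `tilt` is not its default value. -/
lemma tiltMoment_tilt (hm : m ∈ Set.Ioo (0 : ℝ) 1) (hi : IsInner n x t m) :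
    tiltMoment (base n x t H m) m (tilt n x t H m) = 0 := by
  have := h.isProbabilityMeasure_base hm
  obtain ⟨c, hc⟩ := exists_tiltMoment_eq_zero (h.base_compl_Icc hm) (Set.Ioo_subset_Icc_self hm)
    (h.base_Iio_ne_zero hm hi) (h.base_Ioi_ne_zero hm hi)
  have hex : ∃ c, HasDerivAt (psi n x t H m) 0 c := ⟨c, (h.hasDerivAt_psi_iff hm).2 hc⟩
  rw [tilt, dif_pos hex]
  exact (h.hasDerivAt_psi_iff hm).1 hex.choose_spec

lemma fitted_eq (hm : m ∈ Set.Ioo (0 : ℝ) 1) (hi : IsInner n x t m) :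
    fitted n x t H m = tiltedAt (base n x t H m) m (tilt n x t H m) := by
  have := h.isProbabilityMeasure_base hm
  have hp := fun Q => isKLProjection_iff (h.base_compl_Icc hm) (h.tiltMoment_tilt hm hi) (Q := Q)
  have hex : ∃ Q, IsKLProjection (base n x t H m) m Q := ⟨_, (hp _).2 rfl⟩
  rw [fitted, dif_pos hex]
  exact (hp _).1 hex.choose_spec

/-- Locating the root becomes a sign condition at a fixed parameter. This yields both the bounds on
the tilt and its measurability in `m`. -/
lemma tilt_le_iff (hm : m ∈ Set.Ioo (0 : ℝ) 1) (hi : IsInner n x t m) {c : ℝ} :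
    tilt n x t H m ≤ c ↔ 0 ≤ tiltMoment (base n x t H m) m c := by
  have := h.isProbabilityMeasure_base hm
  rw [← h.tiltMoment_tilt hm hi]
  exact (strictMono_tiltMoment (h.base_compl_Icc hm) (h.base_Ioi_ne_zero hm hi)).le_iff_le.symm

lemma integral_exp_nonneg (m c : ℝ) : 0 ≤ t * ∫ z, Real.exp (c * (z - m)) ∂H m :=
  mul_nonneg h.nonneg (integral_nonneg fun _ => (Real.exp_pos _).le)

lemma sum_le_weightZ (m : ℝ) :
    ∑ j ∈ Finset.range n, Real.exp (tilt n x t H m * (x j - m)) ≤ weightZ n x t H m :=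
  le_add_of_nonneg_right (h.integral_exp_nonneg m _)

lemma weightZ_pos (m : ℝ) : 0 < weightZ n x t H m :=
  (Finset.sum_pos (fun _ _ => Real.exp_pos _) ⟨0, Finset.mem_range.2 h.pos⟩).trans_le
    (h.sum_le_weightZ m)

lemma weightZ_eq (hm : m ∈ Set.Ioo (0 : ℝ) 1) :
    weightZ n x t H m = (n + t) * tiltMass (base n x t H m) m (tilt n x t H m) := by
  rw [tiltMass, h.integral_base hm (by fun_prop), weightZ]
  field_simp [h.add_pos.ne']

lemma sum_sub (m : ℝ) :
    ∑ i ∈ Finset.range n, (x i - m) = n * (average n x id - m) := by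
  have := h.cast_pos
  rw [Finset.sum_sub_distrib, average, Finset.sum_const, Finset.card_range, nsmul_eq_mul]
  simp only [id]
  field_simp

lemma prod_weight (m : ℝ) : ∏ i ∈ Finset.range n, weight n x t H m i =
    (Real.exp (tilt n x t H m * (average n x id - m)) / weightZ n x t H m) ^ n := by
  simp only [weight]
  rw [Finset.prod_div_distrib, ← Real.exp_sum, ← Finset.mul_sum, h.sum_sub, Finset.prod_const,
    Finset.card_range, div_pow, ← Real.exp_nat_mul]
  congr 2
  ring

lemma likelihood_of_inner (hi : IsInner n x t m) : likelihood n x t H m =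
    (Real.exp (tilt n x t H m * (average n x id - m)) / weightZ n x t H m) ^ n := by
  rw [likelihood, if_neg, h.prod_weight]
  rintro ⟨h1, h2⟩
  exact hi.elim (· h1) h2

omit h in
lemma likelihood_of_not_inner (hi : ¬ IsInner n x t m) : likelihood n x t H m = 0 := by
  rw [likelihood, if_pos]
  rw [IsInner, not_or, not_not] at hi
  exact hi

lemma likelihood_le_one (m : ℝ) : likelihood n x t H m ≤ 1 := by
  rw [likelihood]
  split_ifs
  · exact zero_le_one
  · refine Finset.prod_le_one (fun i _ => div_nonneg (Real.exp_pos _).le (h.weightZ_pos m).le)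
      fun i hi => (div_le_one (h.weightZ_pos m)).2 ?_
    exact (Finset.single_le_sum (f := fun j => Real.exp (tilt n x t H m * (x j - m)))
      (fun _ _ => (Real.exp_pos _).le) hi).trans (h.sum_le_weightZ m)

lemma average_mem : average n x id ∈ Set.Icc (0 : ℝ) 1 := by
  have := h.cast_pos
  refine ⟨div_nonneg (Finset.sum_nonneg fun i hi => (h.mem i hi).1) this.le,
    (div_le_one this).2 ?_⟩
  refine (Finset.sum_le_sum fun i hi => (h.mem i hi).2).trans ?_
  simp

lemma sum_sq_sub (m : ℝ) : ∑ i ∈ Finset.range n, (x i - m) ^ 2 =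
    n * (average n x (· ^ 2) - average n x id ^ 2 + (average n x id - m) ^ 2) := by
  have hn := h.cast_pos
  have h1 : ∑ i ∈ Finset.range n, x i = n * average n x id := by
    rw [average]; simp only [id]; field_simp
  have h2 : ∑ i ∈ Finset.range n, x i ^ 2 = n * average n x (· ^ 2) := by
    rw [average]; field_simp
  simp only [sub_sq, Finset.sum_add_distrib, Finset.sum_sub_distrib, Finset.sum_const,
    Finset.card_range, nsmul_eq_mul, ← Finset.sum_mul, ← Finset.mul_sum, h1, h2]
  ring

/-- Centring at the sample mean kills the linear term, and the quadratic term sums to the sample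
variance. -/
lemma le_sum_exp {g v c : ℝ} (hg : 0 ≤ g) (hg1 : g ≤ 1) (hgc : g ≤ |c|)
    (hv : v ≤ average n x (· ^ 2) - average n x id ^ 2) :
    n * (1 + g ^ 2 * v / 4) ≤ ∑ i ∈ Finset.range n, Real.exp (c * (x i - average n x id)) := by
  have hX := h.average_mem
  set X := average n x id
  have h1 : ∑ i ∈ Finset.range n, (1 + c * (x i - X) + g ^ 2 / 4 * (x i - X) ^ 2) ≤
      ∑ i ∈ Finset.range n, Real.exp (c * (x i - X)) := by
    refine Finset.sum_le_sum fun i hi => ?_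
    have hx := h.mem i hi
    have h2 : |x i - X| ≤ 1 := abs_le.2 ⟨by linarith [hx.1, hX.2], by linarith [hx.2, hX.1]⟩
    have := one_add_add_sq_le_exp_of_le hg hgc (y := x i - X) (by
      rw [abs_mul, abs_of_nonneg hg]; exact mul_le_one₀ hg1 (abs_nonneg _) h2)
    linarith [mul_pow g (x i - X) 2]
  rw [Finset.sum_add_distrib, Finset.sum_add_distrib, ← Finset.mul_sum, ← Finset.mul_sum,
    h.sum_sub, h.sum_sq_sub] at h1
  simp only [Finset.sum_const, Finset.card_range, nsmul_eq_mul, mul_one] at h1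
  have h3 : X - average n x id = 0 := sub_self _
  rw [h3] at h1
  refine le_trans ?_ h1
  have h4 : g ^ 2 / 4 * (n * v) ≤ g ^ 2 / 4 * (n * (average n x (· ^ 2) - X ^ 2)) := by
    have := h.cast_pos
    gcongr
  nlinarith

/-- A mean far from the sample mean needs a large tilt. -/
lemma le_abs_tilt (hm : m ∈ Set.Ioo (0 : ℝ) 1) (hi : IsInner n x t m) {g : ℝ}
    (hg1 : g ≤ 1) (ht : t ≤ g * n) (hfar : 5 * g ≤ |average n x id - m|) :
    g ≤ |tilt n x t H m| := by
  by_contra! hc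
  have := h.isProbabilityMeasure_base hm
  have := h.prob m hm
  have hB := h.base_compl_Icc hm
  set c := tilt n x t H m
  set B := base n x t H m
  have hroot : tiltMoment B m c = 0 := h.tiltMoment_tilt hm hi
  have hid : Integrable (fun z => z - m) B := integrable_of_continuous hB (by fun_prop)
  have hbd : ∀ z ∈ Set.Icc (0 : ℝ) 1, |z - m| ≤ 1 := fun z hz =>
    abs_le.2 ⟨by linarith [hz.1, hm.2], by linarith [hz.2, hm.1]⟩
  -- The tilted moment vanishes, so the untilted one is bounded by the effect of tilting. After
  -- multiplying by `n + t`, the contributions `2gn`, `2gt ≤ 2gn` and `t ≤ gn` account for the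
  -- constant `5`.
  have h1 : |∫ z, (z - m) ∂B| ≤ 2 * |c| := by
    have : ∫ z, (z - m) ∂B = ∫ z, ((z - m) - (z - m) * Real.exp (c * (z - m))) ∂B := by
      rw [integral_sub hid (integrable_mul_exp hB m c)]
      exact (sub_eq_self.2 hroot).symm
    rw [this, ← Real.norm_eq_abs]
    refine (norm_integral_le_of_norm_le_const (C := 2 * |c|) ?_).trans (by simp)
    filter_upwards [ae_mem_Icc hB] with z hz
    have hz1 := hbd z hz
    have hcz : |c * (z - m)| ≤ |c| := by
      rw [abs_mul]; exact mul_le_of_le_one_right (abs_nonneg c) hz1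
    have h2 := Real.abs_exp_sub_one_le (x := c * (z - m)) (by linarith)
    rw [Real.norm_eq_abs, show (z - m) - (z - m) * Real.exp (c * (z - m)) =
      -((z - m) * (Real.exp (c * (z - m)) - 1)) by ring, abs_neg, abs_mul]
    calc |z - m| * |Real.exp (c * (z - m)) - 1| ≤ 1 * (2 * |c|) := by
          gcongr; linarith
      _ = 2 * |c| := one_mul _
  have h3 : |∫ z, (z - m) ∂H m| ≤ 1 := by
    rw [← Real.norm_eq_abs]
    refine (norm_integral_le_of_norm_le_const (C := 1) ?_).trans (by simp)
    filter_upwards [ae_mem_Icc (h.supp m hm)] with z hz using hbd z hz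
  have h4 := h.integral_base hm (f := fun z => z - m) (by fun_prop)
  rw [h.sum_sub, eq_div_iff h.add_pos.ne'] at h4
  have hn := h.cast_pos
  have h5 : n * |average n x id - m| ≤ 2 * |c| * (n + t) + t := by
    have e : n * (average n x id - m) = (∫ z, (z - m) ∂B) * (n + t) - t * ∫ z, (z - m) ∂H m := by
      linarith
    calc n * |average n x id - m| = |n * (average n x id - m)| := by
          rw [abs_mul, abs_of_pos hn]
      _ ≤ |∫ z, (z - m) ∂B| * (n + t) + t * |∫ z, (z - m) ∂H m| := by
          rw [e]
          refine (abs_sub _ _).trans ?_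
          rw [abs_mul, abs_mul, abs_of_pos h.add_pos, abs_of_nonneg h.nonneg]
      _ ≤ 2 * |c| * (n + t) + t * 1 := by
          have := h.add_pos
          have := h.nonneg
          gcongr
      _ = _ := by ring
  have hc0 := abs_nonneg c
  have ht0 := h.nonneg
  have h6 : n * (5 * g) ≤ n * |average n x id - m| := by gcongr
  have h7 : 2 * |c| * (n + t) < 2 * g * (n + t) := by
    have := h.add_pos
    gcongr
  have h8 : 2 * g * t ≤ 2 * 1 * (g * n) := by
    have : 0 ≤ g := hc0.trans hc.le
    gcongr
  nlinarith

lemma likelihood_le_of_far (hm : m ∈ Set.Ioo (0 : ℝ) 1) {g v : ℝ}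
    (hg : 0 ≤ g) (hg1 : g ≤ 1) (ht : t ≤ g * n) (hfar : 5 * g ≤ |average n x id - m|)
    (hv0 : 0 ≤ v) (hv : v ≤ average n x (· ^ 2) - average n x id ^ 2) :
    likelihood n x t H m ≤ (1 / (n * (1 + g ^ 2 * v / 4))) ^ n := by
  have hn := h.cast_pos
  by_cases hi : IsInner n x t m
  · rw [h.likelihood_of_inner hi]
    have hZ := h.weightZ_pos m
    refine pow_le_pow_left₀ (by positivity) ?_ n
    rw [div_le_div_iff₀ hZ (by positivity), one_mul]
    refine le_trans ?_ (h.sum_le_weightZ m)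
    have h1 := h.le_sum_exp hg hg1 (h.le_abs_tilt hm hi hg1 ht hfar) hv
    have h2 := mul_le_mul_of_nonneg_left h1
      (Real.exp_pos (tilt n x t H m * (average n x id - m))).le
    refine h2.trans_eq ?_
    rw [Finset.mul_sum]
    refine Finset.sum_congr rfl fun i _ => ?_
    rw [← Real.exp_add]
    congr 1
    ring
  · rw [likelihood_of_not_inner hi]
    positivity

lemma le_likelihood (hm : m ∈ Set.Ioo (0 : ℝ) 1) (hi : IsInner n x t m) {s : ℝ}
    (hs : |tilt n x t H m| * |average n x id - m| ≤ s) :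
    (Real.exp (-s) / (n + t)) ^ n ≤ likelihood n x t H m := by
  have := h.isProbabilityMeasure_base hm
  have hnt := h.add_pos
  rw [h.likelihood_of_inner hi]
  refine pow_le_pow_left₀ (by positivity) ?_ n
  have h1 : weightZ n x t H m ≤ n + t := by
    rw [h.weightZ_eq hm]
    exact mul_le_of_le_one_right hnt.le
      (tiltMass_le_one (h.base_compl_Icc hm) (h.tiltMoment_tilt hm hi))
  refine div_le_div₀ (Real.exp_pos _).le (Real.exp_le_exp.2 ?_) (h.weightZ_pos m) h1
  rw [← abs_mul] at hs
  exact (abs_le.1 hs).1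

/-- In units of `n η² v`, the variance contributes at least `1/2`, the offset of the mean costs at
most `1/8` and the regulariser at most `1/16`. -/
lemma mul_tiltMoment_pos (hm : m ∈ Set.Ioo (0 : ℝ) 1) {η v c : ℝ} (hη : 0 < η) (hη1 : η ≤ 1)
    (hc : |c| = η) (hv0 : 0 < v) (hv : v ≤ average n x (· ^ 2) - average n x id ^ 2)
    (hnear : |average n x id - m| ≤ η * v / 8) (ht : t ≤ η * v / 16 * n) :
    0 < c * tiltMoment (base n x t H m) m c := by
  have := h.prob m hm
  have hbd : ∀ z ∈ Set.Icc (0 : ℝ) 1, |c * (z - m)| ≤ η := fun z hz => by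
    rw [abs_mul, hc]
    exact mul_le_of_le_one_right hη.le
      (abs_le.2 ⟨by linarith [hz.1, hm.2], by linarith [hz.2, hm.1]⟩)
  rw [tiltMoment, h.integral_base hm (by fun_prop), mul_div_assoc']
  refine div_pos ?_ h.add_pos
  have h1 : ∑ i ∈ Finset.range n, (c * (x i - m) + c ^ 2 / 2 * (x i - m) ^ 2) ≤
      c * ∑ i ∈ Finset.range n, (x i - m) * Real.exp (c * (x i - m)) := by
    rw [Finset.mul_sum]
    refine Finset.sum_le_sum fun i hi => ?_
    have := add_sq_le_mul_exp ((hbd _ (h.mem i hi)).trans hη1)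
    linarith [mul_pow c (x i - m) 2]
  have h2 : -η ≤ c * ∫ z, (z - m) * Real.exp (c * (z - m)) ∂H m := by
    rw [← integral_const_mul]
    have : ∫ _, -η ∂H m = -η := by simp
    rw [← this]
    refine integral_mono_ae (integrable_const _)
      ((integrable_mul_exp (h.supp m hm) m c).const_mul c) ?_
    filter_upwards [ae_mem_Icc (h.supp m hm)] with z hz
    have h3 := hbd z hz
    have h4 := add_sq_le_mul_exp (h3.trans hη1)
    nlinarith [(abs_le.1 h3).1, sq_nonneg (c * (z - m))]
  rw [Finset.sum_add_distrib, ← Finset.mul_sum, ← Finset.mul_sum, h.sum_sub, h.sum_sq_sub] at h1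
  have hn := h.cast_pos
  have ht0 := h.nonneg
  have hc2 : c ^ 2 = η ^ 2 := by rw [← sq_abs, hc]
  have h5 : -(η * (η * v / 8)) ≤ c * (average n x id - m) := by
    have : |c * (average n x id - m)| ≤ η * (η * v / 8) := by
      rw [abs_mul, hc]; gcongr
    exact (abs_le.1 this).1
  have h6 : η ^ 2 / 2 * v ≤ c ^ 2 / 2 *
      (average n x (· ^ 2) - average n x id ^ 2 + (average n x id - m) ^ 2) := by
    rw [hc2]
    gcongr
    nlinarith [sq_nonneg (average n x id - m)]
  have h7 := mul_le_mul_of_nonneg_left h2 ht0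
  have h8 : t * η ≤ η * v / 16 * n * η := by gcongr
  have h9 := mul_le_mul_of_nonneg_left (add_le_add h5 h6) hn.le
  have h10 : 0 < n * (η ^ 2 * v) := by positivity
  nlinarith

lemma isInner_of_near (hm : m ∈ Set.Ioo (0 : ℝ) 1) {η v : ℝ} (hη : 0 < η) (hη1 : η ≤ 1)
    (hv0 : 0 < v) (hv : v ≤ average n x (· ^ 2) - average n x id ^ 2)
    (hnear : |average n x id - m| ≤ η * v / 8) (ht : t ≤ η * v / 16 * n) :
    IsInner n x t m := by
  by_cases ht0 : t = 0
  swap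
  · exact Or.inl ht0
  refine Or.inr ?_
  -- The signs of the moment at `η` and `-η` produce an observation on each side of `m`. This uses
  -- no root, so it is not circular.
  have key : ∀ c, |c| = η → ∃ i < n, 0 < c * (x i - m) := by
    intro c hc
    have h1 := h.mul_tiltMoment_pos hm hη hη1 hc hv0 hv hnear ht
    rw [tiltMoment, h.integral_base hm (by fun_prop), ht0, zero_mul, add_zero, mul_div_assoc',
      add_zero, Finset.mul_sum] at h1
    by_contra! hcon
    refine absurd h1 (not_lt.2 (div_nonpos_of_nonpos_of_nonneg (Finset.sum_nonpos fun i hi => ?_)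
      h.cast_pos.le))
    rw [← mul_assoc]
    exact mul_nonpos_of_nonpos_of_nonneg (hcon i (Finset.mem_range.1 hi)) (Real.exp_pos _).le
  obtain ⟨i, hi, hi'⟩ := key η (abs_of_pos hη)
  obtain ⟨j, hj, hj'⟩ := key (-η) (by rw [abs_neg, abs_of_pos hη])
  have h1 : m < x i := by nlinarith
  have h2 : x j < m := by nlinarith
  have h3 : Set.Icc (x j) (x i) ⊆ convexHull ℝ (x '' Set.Iio n) := by
    rw [← segment_eq_Icc (h2.trans h1).le]
    exact segment_subset_convexHull (Set.mem_image_of_mem x hj) (Set.mem_image_of_mem x hi)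
  refine interior_mono h3 ?_
  rw [interior_Icc]
  exact ⟨h2, h1⟩

lemma abs_tilt_le_of_near (hm : m ∈ Set.Ioo (0 : ℝ) 1) {η v : ℝ} (hη : 0 < η) (hη1 : η ≤ 1)
    (hv0 : 0 < v) (hv : v ≤ average n x (· ^ 2) - average n x id ^ 2)
    (hnear : |average n x id - m| ≤ η * v / 8) (ht : t ≤ η * v / 16 * n) :
    |tilt n x t H m| ≤ η := by
  have := h.isProbabilityMeasure_base hm
  have hi := h.isInner_of_near hm hη hη1 hv0 hv hnear ht
  have h1 := h.mul_tiltMoment_pos hm hη hη1 (abs_of_pos hη) hv0 hv hnear ht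
  have h2 := h.mul_tiltMoment_pos hm hη hη1 (c := -η) (by rw [abs_neg, abs_of_pos hη]) hv0 hv
    hnear ht
  refine abs_le.2 ⟨?_, (h.tilt_le_iff hm hi).2 (pos_of_mul_pos_right h1 hη.le).le⟩
  by_contra! hc
  have h3 := (h.tilt_le_iff hm hi).1 hc.le
  nlinarith

end Admissible

end Base

/-! ### A coupling bound from cell masses -/

section Wasserstein

variable {ι : Type*} [Fintype ι] {Q P : Measure ℝ} {A : ι → Set ℝ}

lemma sum_restrict_eq (hA : ∀ k, MeasurableSet (A k)) (hd : Pairwise (Function.onFun Disjoint A))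
    (hQ : Q (⋃ k, A k)ᶜ = 0) : ∑ k, Q.restrict (A k) = Q := by
  rw [← Measure.sum_fintype, ← Measure.restrict_iUnion hd hA]
  exact Measure.restrict_eq_self_of_ae_mem (mem_ae_iff.2 hQ)

/-- If `Q` retains the fraction `θ` of the `P`-mass of each cell of a partition of mesh `r`, then
`Q` and `P` have a coupling of cost at most `r + (1 - θ)`. -/
theorem wasserstein1_le_of_partition [IsProbabilityMeasure Q] [IsProbabilityMeasure P]
    (hA : ∀ k, MeasurableSet (A k)) (hd : Pairwise (Function.onFun Disjoint A))
    (hQA : Q (⋃ k, A k)ᶜ = 0) (hPA : P (⋃ k, A k)ᶜ = 0)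
    (hQ : Q (Set.Icc 0 1)ᶜ = 0) (hP : P (Set.Icc 0 1)ᶜ = 0)
    {r θ : ℝ≥0∞} (hr : ∀ k, ∀ x ∈ A k, ∀ y ∈ A k, edist x y ≤ r) (hθ : θ ≤ 1)
    (h : ∀ k, θ * P (A k) ≤ Q (A k)) : wasserstein1 Q P ≤ r + (1 - θ) := by
  set c : ι → ℝ≥0∞ := fun k => θ * (Q (A k))⁻¹ with hc
  have hcP (k : ι) : c k * P (A k) ≤ 1 := by
    calc c k * P (A k) = θ * P (A k) / Q (A k) := by
          simp only [hc, div_eq_mul_inv]; ring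
      _ ≤ 1 := ENNReal.div_le_of_le_mul (by simpa using h k)
  have hcR (k : ι) : (c k * Q (A k)) • P.restrict (A k) = θ • P.restrict (A k) := by
    ext s hs
    simp only [Measure.smul_apply, smul_eq_mul]
    by_cases h0 : Q (A k) = 0
    · have := h k
      rw [h0, nonpos_iff_eq_zero, mul_eq_zero] at this
      rcases this with h1 | h1
      · simp [hc, h1]
      · have : P.restrict (A k) = 0 := Measure.restrict_eq_zero.2 h1
        simp [this]
    · congr 1
      simp only [hc]
      rw [mul_assoc θ, ENNReal.inv_mul_cancel h0 (measure_ne_top _ _), mul_one]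
  -- `ρ₁` couples `θ • P` with part of `Q` inside the cells. The rest `D` of `Q`, of mass `1 - θ`,
  -- is paired independently with `P` itself, so no division by `1 - θ` occurs.
  set ρ₁ : Measure (ℝ × ℝ) := ∑ k, c k • (Q.restrict (A k)).prod (P.restrict (A k)) with hρ₁
  set D : Measure ℝ := ∑ k, (1 - c k * P (A k)) • Q.restrict (A k) with hD
  have hsumQ := sum_restrict_eq hA hd hQA
  have hsumP := sum_restrict_eq hA hd hPA
  have hfst₁ : ρ₁.fst = ∑ k, (c k * P (A k)) • Q.restrict (A k) := by
    ext s hs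
    rw [Measure.fst_apply hs, hρ₁]
    simp only [Measure.coe_finsetSum, Finset.sum_apply, Measure.smul_apply, smul_eq_mul]
    refine Finset.sum_congr rfl fun k _ => ?_
    rw [← Set.prod_univ, Measure.prod_prod]
    simp only [Measure.restrict_apply_univ]
    ring
  have hsnd₁ : ρ₁.snd = θ • P := by
    conv_rhs => rw [← hsumP, Finset.smul_sum]
    simp_rw [← hcR]
    ext s hs
    rw [Measure.snd_apply hs, hρ₁]
    simp only [Measure.coe_finsetSum, Finset.sum_apply, Measure.smul_apply, smul_eq_mul]
    refine Finset.sum_congr rfl fun k _ => ?_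
    rw [← Set.univ_prod, Measure.prod_prod]
    simp only [Measure.restrict_apply_univ]
    ring
  have hDadd : (∑ k, (c k * P (A k)) • Q.restrict (A k)) + D = Q := by
    rw [hD, ← Finset.sum_add_distrib]
    conv_rhs => rw [← hsumQ]
    refine Finset.sum_congr rfl fun k _ => ?_
    rw [← add_smul, add_tsub_cancel_of_le (hcP k), one_smul]
  have hρ₁univ : ρ₁ Set.univ = θ := by
    rw [← Measure.snd_univ, hsnd₁]; simp
  have hDuniv : D Set.univ = 1 - θ := by
    have h1 := congrArg (fun μ : Measure ℝ => μ Set.univ) hDadd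
    rw [← hfst₁] at h1
    simp only [Measure.add_apply, Measure.fst_univ, hρ₁univ, measure_univ] at h1
    exact ENNReal.eq_sub_of_add_eq' (by simp) (by rw [add_comm]; exact h1)
  have hDfin : IsFiniteMeasure D := ⟨by rw [hDuniv]; exact tsub_le_self.trans_lt (by simp)⟩
  have hDQ : D ≪ Q := Measure.absolutelyContinuous_of_le (by
    conv_rhs => rw [← hDadd]
    exact Measure.le_add_left le_rfl)
  have hprod₁ : ∀ᵐ p ∂D.prod P, p.1 ∈ Set.Icc (0 : ℝ) 1 :=
    Measure.quasiMeasurePreserving_fst.ae (ae_mem_Icc (hDQ hQ))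
  have hprod₂ : ∀ᵐ p ∂D.prod P, p.2 ∈ Set.Icc (0 : ℝ) 1 :=
    Measure.quasiMeasurePreserving_snd.ae (ae_mem_Icc hP)
  have hfst : (ρ₁ + D.prod P).fst = Q := by
    rw [Measure.fst, Measure.map_add _ _ measurable_fst]
    change ρ₁.fst + (D.prod P).fst = Q
    rw [Measure.fst_prod, hfst₁, hDadd]
  have hsnd : (ρ₁ + D.prod P).snd = P := by
    rw [Measure.snd, Measure.map_add _ _ measurable_snd]
    change ρ₁.snd + (D.prod P).map Prod.snd = P
    rw [hsnd₁, Measure.map_snd_prod, hDuniv, ← add_smul, add_tsub_cancel_of_le hθ, one_smul]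
  refine (iInf₂_le (ρ₁ + D.prod P) ⟨hfst, hsnd⟩).trans ?_
  rw [lintegral_add_measure]
  refine add_le_add ?_ ?_
  · calc ∫⁻ p, edist p.1 p.2 ∂ρ₁ ≤ ∫⁻ _, r ∂ρ₁ := by
          rw [hρ₁, lintegral_finsetSum_measure, lintegral_finsetSum_measure]
          refine Finset.sum_le_sum fun k _ => ?_
          rw [lintegral_smul_measure, lintegral_smul_measure]
          refine mul_le_mul_right (lintegral_mono_ae ?_) _
          rw [Measure.prod_restrict]
          exact ae_restrict_of_forall_mem ((hA k).prod (hA k))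
            fun p hp => hr k _ hp.1 _ hp.2
      _ ≤ r := by
          rw [lintegral_const, hρ₁univ]
          exact mul_le_of_le_one_right' hθ
  · calc ∫⁻ p, edist p.1 p.2 ∂D.prod P ≤ ∫⁻ _, 1 ∂D.prod P := by
          refine lintegral_mono_ae ?_
          filter_upwards [hprod₁, hprod₂] with p h1 h2
          rw [edist_dist, ← ENNReal.ofReal_one]
          refine ENNReal.ofReal_le_ofReal (abs_le.2 ⟨?_, ?_⟩)
          · linarith [h1.1, h2.2]
          · linarith [h1.2, h2.1]
      _ = 1 - θ := by
          rw [lintegral_one, ← Set.univ_prod_univ, Measure.prod_prod, hDuniv, measure_univ,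
            mul_one]

/-- The cell `[k / K, (k + 1) / K)` of the half-line. -/
def cell (K k : ℕ) : Set ℝ := Set.Ico ((k : ℝ) / K) ((k + 1 : ℝ) / K)

lemma measurableSet_cell (K k : ℕ) : MeasurableSet (cell K k) := measurableSet_Ico

lemma mem_cell_iff {K k : ℕ} (hK : 0 < K) {z : ℝ} (hz : 0 ≤ z) :
    z ∈ cell K k ↔ ⌊z * K⌋₊ = k := by
  have : (0 : ℝ) < K := Nat.cast_pos.2 hK
  rw [Nat.floor_eq_iff (by positivity), cell, Set.mem_Ico, div_le_iff₀ this, lt_div_iff₀ this]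

lemma pairwise_disjoint_cell {K : ℕ} (hK : 0 < K) :
    Pairwise (Function.onFun Disjoint fun k : Fin (K + 1) => cell K k) := by
  refine fun i j hij => Set.disjoint_left.2 fun z hi hj => hij (Fin.ext ?_)
  have hz : 0 ≤ z := le_trans (by positivity) hi.1
  rw [mem_cell_iff hK hz] at hi hj
  exact hi.symm.trans hj

/-- The cells are half-open, so the endpoint `1` requires the extra cell of index `K`. -/
lemma Icc_subset_iUnion_cell {K : ℕ} (hK : 0 < K) :
    Set.Icc (0 : ℝ) 1 ⊆ ⋃ k : Fin (K + 1), cell K k := by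
  intro z hz
  have h1 : ⌊z * K⌋₊ ≤ K := by
    refine (Nat.floor_mono (mul_le_of_le_one_left (Nat.cast_nonneg K) hz.2)).trans ?_
    rw [Nat.floor_natCast]
  exact Set.mem_iUnion.2 ⟨⟨_, Nat.lt_succ_of_le h1⟩, (mem_cell_iff hK hz.1).2 rfl⟩

lemma edist_le_of_mem_cell {K k : ℕ} {y z : ℝ} (hy : y ∈ cell K k) (hz : z ∈ cell K k) :
    edist y z ≤ ENNReal.ofReal (1 / K) := by
  rw [edist_dist]
  refine ENNReal.ofReal_le_ofReal ?_
  have h1 : ((k : ℝ) + 1) / K - k / K = 1 / K := by ring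
  refine (Real.dist_le_of_mem_Icc (Set.Ico_subset_Icc_self hy)
    (Set.Ico_subset_Icc_self hz)).trans h1.le

theorem wasserstein1_le_of_cells [IsProbabilityMeasure Q] [IsProbabilityMeasure P]
    (hQ : Q (Set.Icc 0 1)ᶜ = 0) (hP : P (Set.Icc 0 1)ᶜ = 0) {K : ℕ} (hK : 0 < K) {θ : ℝ≥0∞}
    (hθ : θ ≤ 1) (h : ∀ k ≤ K, θ * P (cell K k) ≤ Q (cell K k)) :
    wasserstein1 Q P ≤ ENNReal.ofReal (1 / K) + (1 - θ) :=
  wasserstein1_le_of_partition (fun k : Fin (K + 1) => measurableSet_cell K k)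
    (pairwise_disjoint_cell hK)
    (measure_mono_null (Set.compl_subset_compl.2 (Icc_subset_iUnion_cell hK)) hQ)
    (measure_mono_null (Set.compl_subset_compl.2 (Icc_subset_iUnion_cell hK)) hP) hQ hP
    (fun _ _ hy _ hz => edist_le_of_mem_cell hy hz) hθ
    fun k => h k (Nat.lt_succ_iff.1 k.2)

end Wasserstein

/-! ### The pseudo-posterior as a ratio of integrals -/

variable {n : ℕ} {x : ℕ → ℝ} {t : ℝ} {H : ℝ → Measure ℝ} {m : ℝ} {π : Measure ℝ}

lemma ae_mem_Ioo (hπ : π (Set.Icc 0 1)ᶜ = 0) (hπac : π ≪ volume) :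
    ∀ᵐ m ∂π, m ∈ Set.Ioo (0 : ℝ) 1 := by
  have h0 : ∀ a : ℝ, ∀ᵐ m ∂π, m ≠ a := fun a => by
    have : ∀ᵐ m : ℝ, m ≠ a := Measure.ae_ne volume a
    exact hπac.ae_le this
  filter_upwards [ae_mem_Icc hπ, h0 0, h0 1] with m h1 h2 h3
  exact ⟨lt_of_le_of_ne h1.1 h2.symm, lt_of_le_of_ne h1.2 h3⟩

lemma measurableSet_isInner : MeasurableSet {m | IsInner n x t m} := by
  by_cases ht : t = 0
  · have : {m | IsInner n x t m} = interior (convexHull ℝ (x '' Set.Iio n)) := by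
      ext m; simp [IsInner, ht]
    rw [this]
    exact isOpen_interior.measurableSet
  · have : {m | IsInner n x t m} = Set.univ := by ext m; simp [IsInner, ht]
    rw [this]
    exact MeasurableSet.univ

lemma posterior_apply [SFinite π] (S : Set ℝ) : posterior n x t H π S =
    (∫⁻ u, ENNReal.ofReal (likelihood n x t H u) ∂π)⁻¹ *
      ∫⁻ u in S, ENNReal.ofReal (likelihood n x t H u) ∂π := by
  simp [posterior, withDensity_apply']

lemma posterior_absolutelyContinuous : posterior n x t H π ≪ π :=
  (withDensity_absolutelyContinuous π _).smul_left _

lemma ofReal_mul_le_lintegral_likelihood {l : ℝ} {N : Set ℝ}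
    (hN : ∀ m ∈ N, l ≤ likelihood n x t H m) (hNm : MeasurableSet N) :
    ENNReal.ofReal l * π N ≤ ∫⁻ u, ENNReal.ofReal (likelihood n x t H u) ∂π := by
  rw [← setLIntegral_const]
  refine le_trans ?_ (setLIntegral_le_lintegral N _)
  exact setLIntegral_mono' hNm fun m hm => ENNReal.ofReal_le_ofReal (hN m hm)

namespace Admissible

variable (h : Admissible n x t H)
include h

lemma isProbabilityMeasure_posterior [IsProbabilityMeasure π] {l : ℝ} (hl : 0 < l) {N : Set ℝ}
    (hN : ∀ m ∈ N, l ≤ likelihood n x t H m) (hNm : MeasurableSet N) (hN0 : π N ≠ 0) :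
    IsProbabilityMeasure (posterior n x t H π) := by
  refine ⟨?_⟩
  rw [posterior_apply, setLIntegral_univ]
  refine ENNReal.inv_mul_cancel ?_ ?_
  · exact ((ENNReal.mul_pos (ENNReal.ofReal_pos.2 hl).ne' hN0).trans_le
      (ofReal_mul_le_lintegral_likelihood hN hNm)).ne'
  · refine ne_top_of_le_ne_top ENNReal.one_ne_top ?_
    calc ∫⁻ u, ENNReal.ofReal (likelihood n x t H u) ∂π ≤ ∫⁻ _, 1 ∂π :=
          lintegral_mono fun u => ENNReal.ofReal_le_one.2 (h.likelihood_le_one u)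
      _ = 1 := by simp

omit h in
lemma posterior_le [IsProbabilityMeasure π] {l a : ℝ} (hl : 0 < l) {N S : Set ℝ}
    (hN : ∀ m ∈ N, l ≤ likelihood n x t H m) (hNm : MeasurableSet N)
    (hS : ∀ᵐ m ∂π, m ∈ S → likelihood n x t H m ≤ a) (hSm : MeasurableSet S) :
    posterior n x t H π S ≤ ENNReal.ofReal (a / l) / π N := by
  have h1 : ∫⁻ u in S, ENNReal.ofReal (likelihood n x t H u) ∂π ≤ ENNReal.ofReal a := by
    calc ∫⁻ u in S, ENNReal.ofReal (likelihood n x t H u) ∂π ≤ ∫⁻ _ in S, ENNReal.ofReal a ∂π := by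
          refine lintegral_mono_ae ?_
          rw [ae_restrict_iff' hSm]
          filter_upwards [hS] with m hm hmS using ENNReal.ofReal_le_ofReal (hm hmS)
      _ ≤ ENNReal.ofReal a := by
          rw [setLIntegral_const]
          exact mul_le_of_le_one_right' prob_le_one
  rw [posterior_apply, mul_comm, ← div_eq_mul_inv]
  refine (ENNReal.div_le_div h1 (ofReal_mul_le_lintegral_likelihood hN hNm)).trans_eq ?_
  have h2 : ENNReal.ofReal l ≠ 0 := (ENNReal.ofReal_pos.2 hl).ne'
  rw [ENNReal.ofReal_div_of_pos hl, div_eq_mul_inv, div_eq_mul_inv, div_eq_mul_inv,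
    ENNReal.mul_inv (Or.inl h2) (Or.inl ENNReal.ofReal_ne_top), mul_assoc]

omit h in
-- The likelihood vanishes at the other points, so default values of `tilt` and `fitted` are never
-- seen by the posterior.
lemma ae_inner (hπ : ∀ᵐ m ∂π, m ∈ Set.Ioo (0 : ℝ) 1) [SFinite π] :
    ∀ᵐ m ∂posterior n x t H π, m ∈ Set.Ioo (0 : ℝ) 1 ∧ IsInner n x t m := by
  refine Filter.Eventually.and (posterior_absolutelyContinuous.ae_le hπ) ?_
  have : {m | IsInner n x t m}ᶜ.indicator
      (fun u => ENNReal.ofReal (likelihood n x t H u)) = 0 := by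
    ext m
    by_cases hi : IsInner n x t m
    · simp [hi]
    · simp [likelihood_of_not_inner hi]
  change posterior n x t H π {m | IsInner n x t m}ᶜ = 0
  rw [posterior_apply, ← lintegral_indicator measurableSet_isInner.compl, this]
  simp

end Admissible

/-! ### Measurability in the mean, and the predictive -/

section Measurability

/-- The regularised empirical distribution where `m` lies in the open unit interval, and a Dirac
mass elsewhere. -/
noncomputable def baseKernel (n : ℕ) (x : ℕ → ℝ) (t : ℝ) (H : ℝ → Measure ℝ)
    (hH : Measurable H) : Kernel ℝ ℝ where
  toFun := open Classical in fun m => if m ∈ Set.Ioo (0 : ℝ) 1 then base n x t H m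
    else Measure.dirac 0
  measurable' := by
    classical
    refine Measurable.ite measurableSet_Ioo ?_ measurable_const
    refine Measure.measurable_of_measurable_coe _ fun s hs => ?_
    have := (Measure.measurable_coe hs).comp hH
    simp only [base, Measure.add_apply, Measure.smul_apply, smul_eq_mul]
    exact measurable_const.add (measurable_const.mul this)

lemma baseKernel_apply (hH : Measurable H) (hm : m ∈ Set.Ioo (0 : ℝ) 1) :
    baseKernel n x t H hH m = base n x t H m := if_pos hm

namespace Admissible

variable (h : Admissible n x t H) (hH : Measurable H)
include h hH

lemma isMarkovKernel_baseKernel : IsMarkovKernel (baseKernel n x t H hH) := by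
  refine ⟨fun m => ?_⟩
  by_cases hm : m ∈ Set.Ioo (0 : ℝ) 1
  · rw [baseKernel_apply hH hm]
    exact h.isProbabilityMeasure_base hm
  · have : baseKernel n x t H hH m = Measure.dirac 0 := if_neg hm
    rw [this]
    infer_instance

lemma measurable_indicator_tilt :
    Measurable ({m | m ∈ Set.Ioo (0 : ℝ) 1 ∧ IsInner n x t m}.indicator (tilt n x t H)) := by
  have := h.isMarkovKernel_baseKernel hH
  refine measurable_of_Iic fun c => ?_
  set G := {m | m ∈ Set.Ioo (0 : ℝ) 1 ∧ IsInner n x t m} with hG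
  have hGm : MeasurableSet G := measurableSet_Ioo.inter measurableSet_isInner
  have hm : Measurable fun m => tiltMoment (baseKernel n x t H hH m) m c := by
    have : StronglyMeasurable (Function.uncurry fun m z : ℝ =>
      (z - m) * Real.exp (c * (z - m))) := by
      refine Measurable.stronglyMeasurable ?_
      simp only [Function.uncurry_def]
      fun_prop
    exact this.integral_kernel_prod_right.measurable
  -- Although `tilt` is defined by choice, its sublevel sets on `G` are sign conditions on moments,
  -- which depend measurably on `m`.
  have : G.indicator (tilt n x t H) ⁻¹' Set.Iic c =
      (G ∩ {m | 0 ≤ tiltMoment (baseKernel n x t H hH m) m c}) ∪ (Gᶜ ∩ {_m | 0 ≤ c}) := by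
    ext m
    by_cases hmG : m ∈ G
    · have e := h.tilt_le_iff hmG.1 hmG.2 (c := c)
      simp [hmG, e, baseKernel_apply hH hmG.1]
    · simp [hmG]
  rw [this]
  exact (hGm.inter (measurableSet_le measurable_const hm)).union
    (hGm.compl.inter (MeasurableSet.const _))

/-- Needed for `Measure.bind` to be the intended mixture. Posterior-almost everywhere, `fitted` is a
kernel with an explicit jointly measurable density. -/
lemma aemeasurable_fitted [SFinite π] (hπ : ∀ᵐ m ∂π, m ∈ Set.Ioo (0 : ℝ) 1) :
    AEMeasurable (fitted n x t H) (posterior n x t H π) := by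
  have := h.isMarkovKernel_baseKernel hH
  set γ := {m | m ∈ Set.Ioo (0 : ℝ) 1 ∧ IsInner n x t m}.indicator (tilt n x t H) with hγ
  have hγm : Measurable γ := h.measurable_indicator_tilt hH
  have hmass : Measurable fun m => tiltMass (baseKernel n x t H hH m) m (γ m) := by
    have : StronglyMeasurable (Function.uncurry fun m z : ℝ => Real.exp (γ m * (z - m))) := by
      refine Measurable.stronglyMeasurable ?_
      simp only [Function.uncurry_def]
      fun_prop
    exact this.integral_kernel_prod_right.measurable
  have hdens : Measurable (Function.uncurry fun m z : ℝ =>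
      ENNReal.ofReal (Real.exp (γ m * (z - m)) /
        tiltMass (baseKernel n x t H hH m) m (γ m))) := by
    simp only [Function.uncurry_def]
    refine ENNReal.measurable_ofReal.comp (Measurable.div (by fun_prop) ?_)
    exact hmass.comp measurable_fst
  refine ⟨_, (Kernel.withDensity (baseKernel n x t H hH) fun m z =>
    ENNReal.ofReal (Real.exp (γ m * (z - m)) /
      tiltMass (baseKernel n x t H hH m) m (γ m))).measurable, ?_⟩
  filter_upwards [ae_inner hπ] with m hm
  rw [Kernel.withDensity_apply _ hdens, h.fitted_eq hm.1 hm.2, baseKernel_apply hH hm.1,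
    hγ, Set.indicator_of_mem (s := {m | m ∈ Set.Ioo (0 : ℝ) 1 ∧ IsInner n x t m}) hm]
  rfl

lemma predictive_apply [SFinite π] (hπ : ∀ᵐ m ∂π, m ∈ Set.Ioo (0 : ℝ) 1)
    {A : Set ℝ} (hA : MeasurableSet A) :
    predictive n x t H π A = ∫⁻ m, fitted n x t H m A ∂posterior n x t H π :=
  Measure.bind_apply hA (h.aemeasurable_fitted hH hπ)

lemma isProbabilityMeasure_predictive [SFinite π] (hπ : ∀ᵐ m ∂π, m ∈ Set.Ioo (0 : ℝ) 1)
    [IsProbabilityMeasure (posterior n x t H π)] :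
    IsProbabilityMeasure (predictive n x t H π) := by
  refine ⟨?_⟩
  rw [h.predictive_apply hH hπ MeasurableSet.univ]
  have : ∫⁻ m, fitted n x t H m Set.univ ∂posterior n x t H π =
      ∫⁻ _, 1 ∂posterior n x t H π := by
    refine lintegral_congr_ae ?_
    filter_upwards [ae_inner hπ] with m hm
    have := h.isProbabilityMeasure_base hm.1
    have := isProbabilityMeasure_tiltedAt (m := m) (c := tilt n x t H m) (h.base_compl_Icc hm.1)
    rw [h.fitted_eq hm.1 hm.2, measure_univ]
  rw [this]
  simp

lemma predictive_compl_Icc [SFinite π] (hπ : ∀ᵐ m ∂π, m ∈ Set.Ioo (0 : ℝ) 1) :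
    predictive n x t H π (Set.Icc 0 1)ᶜ = 0 := by
  rw [h.predictive_apply hH hπ measurableSet_Icc.compl, ← lintegral_zero]
  refine lintegral_congr_ae ?_
  filter_upwards [ae_inner hπ] with m hm
  rw [h.fitted_eq hm.1 hm.2, tiltedAt_compl_Icc (h.base_compl_Icc hm.1)]

lemma le_predictive [SFinite π] (hπ : ∀ᵐ m ∂π, m ∈ Set.Ioo (0 : ℝ) 1) {N : Set ℝ}
    (hNm : MeasurableSet N) {η : ℝ}
    (hN : ∀ m ∈ N, m ∈ Set.Ioo (0 : ℝ) 1 → IsInner n x t m → |tilt n x t H m| ≤ η)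
    {A : Set ℝ} (hA : MeasurableSet A) :
    ENNReal.ofReal (Real.exp (-η)) * (ENNReal.ofReal (n / (n + t)) * empirical n x A) *
      posterior n x t H π N ≤ predictive n x t H π A := by
  rw [h.predictive_apply hH hπ hA, ← setLIntegral_const]
  refine le_trans (lintegral_mono_ae ?_) (setLIntegral_le_lintegral N _)
  rw [ae_restrict_iff' hNm]
  filter_upwards [ae_inner hπ] with m hm hmN
  have := h.isProbabilityMeasure_base hm.1
  rw [h.fitted_eq hm.1 hm.2]
  refine le_trans ?_ (ofReal_exp_mul_le_tiltedAt (h.base_compl_Icc hm.1)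
    (Set.Ioo_subset_Icc_self hm.1) (h.tiltMoment_tilt hm.1 hm.2) (hN m hmN hm.1 hm.2) hA)
  exact mul_le_mul_right (ofReal_mul_empirical_le_base m A) _

end Admissible

end Measurability

/-! ### Posterior concentration on good samples -/

section Concentration

variable {H : ℝ → Measure ℝ} {π : Measure ℝ} {μ v : ℝ}

/-- Uniform control of the tilting parameter for means near `μ`. -/
lemma exists_abs_tilt_le (hv : 0 < v) {η : ℝ} (hη : 0 < η) :
    ∃ δ > 0, ∀ n x t, Admissible n x t H → |average n x id - μ| ≤ δ →
      v ≤ average n x (· ^ 2) - average n x id ^ 2 → t ≤ δ * n →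
      ∀ m ∈ Set.Ioo (0 : ℝ) 1, |m - μ| ≤ δ → |tilt n x t H m| ≤ η := by
  set e := min η 1
  have he : 0 < e := lt_min hη one_pos
  refine ⟨e * v / 16, by positivity, fun n x t h hμ hV ht m hm hmμ => ?_⟩
  refine (h.abs_tilt_le_of_near hm he (min_le_right _ _) hv hV ?_ ht).trans (min_le_left _ _)
  have := abs_sub_le (average n x id) μ m
  rw [abs_sub_comm μ m] at this
  linarith

/-- The pseudo-posterior is well defined and concentrates exponentially fast on every sample whose
first two moments are close to their limits. -/
theorem exists_posterior_le [IsProbabilityMeasure π] (hμ : μ ∈ Set.Ioo (0 : ℝ) 1) (hv : 0 < v)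
    (hπ : ∀ᵐ m ∂π, m ∈ Set.Ioo (0 : ℝ) 1) (hπμ : ∀ e > 0, π (Metric.ball μ e) ≠ 0)
    {ε : ℝ} (hε : 0 < ε) :
    ∃ δ > 0, ∃ C : ℝ≥0∞, C ≠ ∞ ∧ ∃ r < 1, ∀ n x t, Admissible n x t H →
      |average n x id - μ| ≤ δ → v ≤ average n x (· ^ 2) - average n x id ^ 2 → t ≤ δ * n →
      IsProbabilityMeasure (posterior n x t H π) ∧
        posterior n x t H π {m | ε < |m - μ|} ≤ C * r ^ n := by
  set g := min (ε / 10) 1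
  have hg : 0 < g := lt_min (by positivity) one_pos
  have hg1 : g ≤ 1 := min_le_right _ _
  have hgε : g ≤ ε / 10 := min_le_left _ _
  set q := 1 + g ^ 2 * v / 4
  have hq : 1 < q := by
    have : 0 < g ^ 2 * v / 4 := by positivity
    simp only [q]; linarith
  -- With `q = exp (4s)`, one `s` is spent on the near likelihood and one on `n + t ≤ n exp s`. The
  -- remaining rate is `2s`.
  set s := Real.log q / 4 with hs
  have hs0 : 0 < s := div_pos (Real.log_pos hq) (by norm_num)
  have hqs : q = Real.exp (4 * s) := by
    rw [hs, mul_div_cancel₀ _ (by norm_num), Real.exp_log (by linarith)]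
  -- On the ball of radius `e`, `m` lies in (0,1) and within `2e` of the sample mean: `2e ≤ v / 8`
  -- gives a tilt of at most `1`, and `2e ≤ s` bounds the exponent.
  obtain ⟨e, he, he1, he2, he3, he4⟩ : ∃ e > 0, e ≤ v / 16 ∧ e ≤ s / 2 ∧ e ≤ μ ∧ e ≤ 1 - μ := by
    refine ⟨min (min (v / 16) (s / 2)) (min μ (1 - μ)), ?_, ?_, ?_, ?_, ?_⟩
    · have := hμ.1
      have := sub_pos.2 hμ.2
      positivity
    all_goals simp
  obtain ⟨δ, hδ, hδ1, hδ2, hδ3, hδ4, hδ5⟩ :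
      ∃ δ > 0, δ ≤ e ∧ δ ≤ ε / 2 ∧ δ ≤ v / 16 ∧ δ ≤ s ∧ δ ≤ g := by
    refine ⟨min (min e (ε / 2)) (min (v / 16) (min s g)), by positivity, ?_, ?_, ?_, ?_, ?_⟩
    all_goals simp
  refine ⟨δ, hδ, (π (Metric.ball μ e))⁻¹, ENNReal.inv_ne_top.2 (hπμ e he),
    ENNReal.ofReal (Real.exp (-(2 * s))), ?_, fun n x t h hX hV ht => ?_⟩
  · rw [ENNReal.ofReal_lt_one, Real.exp_lt_one_iff]
    linarith
  have hn := h.cast_pos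
  have hnt := h.add_pos
  have hN : ∀ m ∈ Metric.ball μ e, (Real.exp (-s) / (n + t)) ^ n ≤ likelihood n x t H m := by
    intro m hm
    rw [Metric.mem_ball, Real.dist_eq] at hm
    obtain ⟨hm1, hm2⟩ := abs_lt.1 hm
    have hmI : m ∈ Set.Ioo (0 : ℝ) 1 := ⟨by linarith, by linarith⟩
    have hXm : |average n x id - m| ≤ 2 * e := by
      have := abs_sub_le (average n x id) μ m
      rw [abs_sub_comm μ m] at this
      linarith
    have hnear : |average n x id - m| ≤ 1 * v / 8 := by linarith
    have ht' : t ≤ 1 * v / 16 * n := ht.trans (by gcongr; linarith)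
    refine h.le_likelihood hmI (h.isInner_of_near hmI one_pos le_rfl hv hV hnear ht') ?_
    calc |tilt n x t H m| * |average n x id - m| ≤ 1 * (2 * e) :=
          mul_le_mul (h.abs_tilt_le_of_near hmI one_pos le_rfl hv hV hnear ht') hXm
            (abs_nonneg _) zero_le_one
      _ ≤ s := by linarith
  have hfar : ∀ᵐ m ∂π, m ∈ {m | ε < |m - μ|} →
      likelihood n x t H m ≤ (1 / (n * q)) ^ n := by
    filter_upwards [hπ] with m hm hmε
    refine h.likelihood_le_of_far hm hg.le hg1 (ht.trans (by gcongr)) ?_ hv.le hV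
    have := abs_sub_le m (average n x id) μ
    rw [abs_sub_comm m (average n x id)] at this
    have h2 : ε < |m - μ| := hmε
    linarith
  have hl : 0 < (Real.exp (-s) / (n + t)) ^ n := by positivity
  refine ⟨h.isProbabilityMeasure_posterior hl hN Metric.isOpen_ball.measurableSet (hπμ e he), ?_⟩
  refine (Admissible.posterior_le hl hN Metric.isOpen_ball.measurableSet hfar
    (measurableSet_lt measurable_const (by fun_prop))).trans ?_
  rw [div_eq_mul_inv, mul_comm, ← ENNReal.ofReal_pow (Real.exp_pos _).le]
  refine mul_le_mul_right (ENNReal.ofReal_le_ofReal ?_) _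
  rw [← div_pow]
  refine pow_le_pow_left₀ (by positivity) ?_ n
  have h1 : n + t ≤ n * Real.exp s := by
    have h2 := Real.add_one_le_exp s
    have h3 : t ≤ s * n := ht.trans (by gcongr)
    nlinarith
  rw [div_div_eq_mul_div, div_le_iff₀ (Real.exp_pos _), one_div, inv_mul_le_iff₀ (by positivity),
    hqs]
  calc (n : ℝ) + t ≤ n * Real.exp s := h1
    _ = n * Real.exp (4 * s) * (Real.exp (-(2 * s)) * Real.exp (-s)) := by
        rw [mul_assoc, ← Real.exp_add, ← Real.exp_add]
        congr 2
        ring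

lemma empirical_eq_ofReal_average {n : ℕ} {x : ℕ → ℝ} (hn : 0 < n) {A : Set ℝ}
    (hA : MeasurableSet A) :
    empirical n x A = ENNReal.ofReal (average n x (A.indicator 1)) := by
  have h0 : ∀ i ∈ Finset.range n, 0 ≤ A.indicator (1 : ℝ → ℝ) (x i) := fun i _ =>
    Set.indicator_nonneg (fun _ _ => zero_le_one) _
  rw [empirical_apply, average, div_eq_inv_mul,
    ENNReal.ofReal_mul (by positivity), ENNReal.ofReal_inv_of_pos (Nat.cast_pos.2 hn),
    ENNReal.ofReal_natCast, ENNReal.ofReal_sum_of_nonneg h0]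
  congr 1
  refine Finset.sum_congr rfl fun i _ => ?_
  rw [Measure.dirac_apply' _ hA]
  by_cases hi : x i ∈ A <;> simp [hi]

end Concentration

/-! ### Events of high probability and the law of large numbers -/

section HighProbability

variable {Ω : Type*} [MeasurableSpace Ω] {P : Measure Ω}

/-- The events `p n` have probability tending to one. -/
def WithHighProb (P : Measure Ω) (p : ℕ → Ω → Prop) : Prop :=
  Tendsto (fun n => P {ω | ¬ p n ω}) atTop (𝓝 0)

lemma WithHighProb.mono {p q : ℕ → Ω → Prop} (hp : WithHighProb P p)
    (h : ∀ᶠ n in atTop, ∀ᵐ ω ∂P, p n ω → q n ω) : WithHighProb P q := by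
  refine tendsto_of_tendsto_of_tendsto_of_le_of_le' tendsto_const_nhds hp
    (Eventually.of_forall fun _ => zero_le) ?_
  filter_upwards [h] with n hn
  refine measure_mono_ae ?_
  filter_upwards [hn] with ω hω hq hp using hq (hω hp)

lemma WithHighProb.and {p q : ℕ → Ω → Prop} (hp : WithHighProb P p) (hq : WithHighProb P q) :
    WithHighProb P fun n ω => p n ω ∧ q n ω := by
  have := Tendsto.add hp hq
  rw [add_zero] at this
  refine tendsto_of_tendsto_of_tendsto_of_le_of_le tendsto_const_nhds this
    (fun _ => zero_le) fun n => (measure_mono fun ω hω => ?_).trans (measure_union_le _ _)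
  exact not_and_or.1 hω

lemma withHighProb_forall_finset {ι : Type*} {p : ι → ℕ → Ω → Prop} (s : Finset ι)
    (h : ∀ k ∈ s, WithHighProb P (p k)) : WithHighProb P fun n ω => ∀ k ∈ s, p k n ω := by
  have := tendsto_finsetSum s h
  simp only [Finset.sum_const_zero] at this
  refine tendsto_of_tendsto_of_tendsto_of_le_of_le tendsto_const_nhds this
    (fun _ => zero_le) fun n => (measure_mono fun ω hω => ?_).trans
      (measure_biUnion_finset_le s fun k => {ω | ¬ p k n ω})
  have : ¬ ∀ k ∈ s, p k n ω := hω
  push Not at this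
  obtain ⟨k, hk, hk'⟩ := this
  exact Set.mem_biUnion hk hk'

lemma tendstoZeroInProb_of_withHighProb {Y : ℕ → Ω → ℝ≥0∞}
    (h : ∀ δ > 0, WithHighProb P fun n ω => Y n ω < δ) : TendstoZeroInProb P Y := fun δ hδ => by
  simpa [WithHighProb] using h δ hδ

variable [IsProbabilityMeasure P] {Pstar : Measure ℝ}
  {X : ℕ → Ω → ℝ} (hXm : ∀ i, Measurable (X i)) (hXindep : iIndepFun X P)
  (hXlaw : ∀ i, P.map (X i) = Pstar)
include hXm hXindep hXlaw

/-- The weak law of large numbers for averages of functions of the data. -/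
lemma withHighProb_average {f : ℝ → ℝ} (hf : Measurable f) (hfi : Integrable f Pstar) {δ : ℝ}
    (hδ : 0 < δ) :
    WithHighProb P fun n ω => |average n (fun i => X i ω) f - ∫ z, f z ∂Pstar| < δ := by
  have hint : Integrable (fun ω => f (X 0 ω)) P := by
    have := (integrable_map_measure (μ := P) (f := X 0) (g := f)
      (hf.aestronglyMeasurable) (hXm 0).aemeasurable).1 (by rwa [hXlaw 0])
    exact this
  have hE : ∫ ω, f (X 0 ω) ∂P = ∫ z, f z ∂Pstar := by
    rw [← hXlaw 0, integral_map (hXm 0).aemeasurable hf.aestronglyMeasurable]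
  have hslln := strong_law_ae_real (fun i ω => f (X i ω)) hint
    (fun i j hij => (hXindep.indepFun hij).comp hf hf)
    (fun i => IdentDistrib.comp ⟨(hXm i).aemeasurable, (hXm 0).aemeasurable,
      by rw [hXlaw, hXlaw]⟩ hf)
  have hm (n : ℕ) : Measurable fun ω => (∑ i ∈ Finset.range n, f (X i ω)) / n := by fun_prop
  have := tendstoInMeasure_iff_dist.1 (tendstoInMeasure_of_tendsto_ae
    (fun n => (hm n).aestronglyMeasurable) hslln) δ hδ
  simp only [Real.dist_eq, hE] at this
  simpa [WithHighProb, average] using this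

end HighProbability

lemma measure_ball_ne_zero_of_rnDeriv {π : Measure ℝ} [IsFiniteMeasure π] (hπac : π ≪ volume)
    {μ : ℝ} (hπpos : ∃ c : ℝ≥0∞, 0 < c ∧ ∃ U ∈ 𝓝 μ, ∀ᵐ x : ℝ, x ∈ U → c ≤ π.rnDeriv volume x)
    {e : ℝ} (he : 0 < e) : π (Metric.ball μ e) ≠ 0 := by
  obtain ⟨c, hc, U, hU, hcU⟩ := hπpos
  obtain ⟨e', he', hball⟩ := Metric.mem_nhds_iff.1 hU
  have h1 : c * volume (Metric.ball μ (min e e')) ≤ π (Metric.ball μ (min e e')) := by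
    rw [← setLIntegral_const, ← Measure.setLIntegral_rnDeriv hπac]
    refine lintegral_mono_ae ?_
    rw [ae_restrict_iff' Metric.isOpen_ball.measurableSet]
    filter_upwards [hcU] with x hx hxb
    exact hx (hball (Metric.ball_subset_ball (min_le_right _ _) hxb))
  have h2 : 0 < volume (Metric.ball μ (min e e')) :=
    Metric.measure_ball_pos _ _ (lt_min he he')
  exact ((ENNReal.mul_pos hc.ne' h2.ne').trans_le
    (h1.trans (measure_mono (Metric.ball_subset_ball (min_le_left _ _))))).ne'

section

variable {Ω : Type*} [MeasurableSpace Ω] {P : Measure Ω} [IsProbabilityMeasure P]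
  {Pstar : Measure ℝ} [IsProbabilityMeasure Pstar]
  {X : ℕ → Ω → ℝ} (hXm : ∀ i, Measurable (X i)) (hXindep : iIndepFun X P)
  (hXlaw : ∀ i, P.map (X i) = Pstar) (hPstar : Pstar (Set.Icc 0 1)ᶜ = 0)
include hXm hXlaw hPstar in
omit [IsProbabilityMeasure P] [IsProbabilityMeasure Pstar] in
lemma ae_forall_mem_Icc : ∀ᵐ ω ∂P, ∀ i, X i ω ∈ Set.Icc (0 : ℝ) 1 := by
  refine ae_all_iff.2 fun i => ?_
  have := hPstar
  rw [← hXlaw i] at this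
  exact ae_of_ae_map (hXm i).aemeasurable (ae_mem_Icc this)

include hXm hXindep hXlaw hPstar

lemma withHighProb_moments {μ : ℝ} (hmean : ∫ x, x ∂Pstar = μ) {δ : ℝ} (hδ : 0 < δ)
    (hvar : 0 < variance (fun x : ℝ => x) Pstar) {τ : ℕ → ℝ} (hτ0 : ∀ n, 0 ≤ τ n)
    (hτ : τ =o[atTop] fun n : ℕ => (n : ℝ)) {H : ℝ → Measure ℝ}
    (hHprob : ∀ m ∈ Set.Ioo (0 : ℝ) 1, IsProbabilityMeasure (H m))
    (hHsupp : ∀ m ∈ Set.Ioo (0 : ℝ) 1, H m (Set.Icc 0 1)ᶜ = 0)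
    (hHconv : ∀ m ∈ Set.Ioo (0 : ℝ) 1, convexHull ℝ (H m).support = Set.Icc 0 1) :
    WithHighProb P fun n ω => Admissible n (fun i => X i ω) (τ n) H ∧
      |average n (fun i => X i ω) id - μ| ≤ δ ∧
      variance (fun x : ℝ => x) Pstar / 2 ≤ average n (fun i => X i ω) (· ^ 2) -
        average n (fun i => X i ω) id ^ 2 ∧ τ n ≤ δ * n := by
  have hvar_eq : variance (fun x : ℝ => x) Pstar = ∫ x, x ^ 2 ∂Pstar - μ ^ 2 := by
    have hmem : MemLp (fun x : ℝ => x) 2 Pstar :=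
      (memLp_two_iff_integrable_sq (by fun_prop)).2
        (integrable_of_continuous hPstar (by fun_prop))
    rw [variance_eq_sub hmem, hmean]
    simp
  have hμ : μ ∈ Set.Icc (0 : ℝ) 1 := by
    rw [← hmean]
    refine ⟨integral_nonneg_of_ae ((ae_mem_Icc hPstar).mono fun _ h => h.1), ?_⟩
    have : ∫ x, x ∂Pstar ≤ ∫ _, (1 : ℝ) ∂Pstar :=
      integral_mono_ae (integrable_of_continuous hPstar (by fun_prop)) (integrable_const _)
        ((ae_mem_Icc hPstar).mono fun _ h => h.2)
    simpa using this
  set σ := variance (fun x : ℝ => x) Pstar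
  -- The second moment errs by `e` and the squared mean by `2e`, so half the variance survives.
  set e := min δ (σ / 6)
  have he : 0 < e := lt_min hδ (by positivity)
  have h1 := withHighProb_average hXm hXindep hXlaw (f := id) measurable_id
    (integrable_of_continuous hPstar continuous_id) he
  have h2 := withHighProb_average hXm hXindep hXlaw (f := (· ^ 2)) (by fun_prop)
    (integrable_of_continuous hPstar (by fun_prop)) he
  refine (h1.and h2).mono ?_
  filter_upwards [eventually_gt_atTop 0, hτ.bound hδ] with n hn hτn
  filter_upwards [ae_forall_mem_Icc hXm hXlaw hPstar] with ω hω ⟨ha, hb⟩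
  have hadm : Admissible n (fun i => X i ω) (τ n) H :=
    ⟨hn, fun i _ => hω i, hτ0 n, hHprob, hHsupp, hHconv⟩
  simp only [id, hmean] at ha
  obtain ⟨ha1, ha2⟩ := abs_lt.1 ha
  obtain ⟨hb1, hb2⟩ := abs_lt.1 hb
  have hA := hadm.average_mem
  refine ⟨hadm, ha.le.trans (min_le_left _ _), ?_, ?_⟩
  · have heσ : e ≤ σ / 6 := min_le_right _ _
    change -e < average n (fun i => X i ω) id - μ at ha1
    change average n (fun i => X i ω) id - μ < e at ha2
    have h3 : average n (fun i => X i ω) id ^ 2 - μ ^ 2 ≤ 2 * e := by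
      have h4 : average n (fun i => X i ω) id ^ 2 - μ ^ 2 =
        (average n (fun i => X i ω) id - μ) * (average n (fun i => X i ω) id + μ) := by ring
      rw [h4]
      nlinarith [hA.1, hA.2, hμ.1, hμ.2]
    linarith
  · simpa [abs_of_nonneg (hτ0 n)] using hτn

omit hPstar in
-- The error is relative, as the coupling requires: the law of large numbers is used at accuracy `η
-- * Pstar A`, and null sets are trivial.
lemma withHighProb_empirical {η : ℝ} (hη : 0 < η) {A : Set ℝ} (hA : MeasurableSet A) :
    WithHighProb P fun n ω =>
      ENNReal.ofReal (1 - η) * Pstar A ≤ empirical n (fun i => X i ω) A := by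
  by_cases h0 : Pstar A = 0
  · simp [WithHighProb, h0]
  have hp : 0 < Pstar.real A := ENNReal.toReal_pos h0 (measure_ne_top _ _)
  have hint : ∫ z, A.indicator (1 : ℝ → ℝ) z ∂Pstar = Pstar.real A := integral_indicator_one hA
  refine (withHighProb_average hXm hXindep hXlaw (f := A.indicator 1)
    (measurable_one.indicator hA) ((integrable_const (1 : ℝ)).indicator hA)
    (mul_pos hη hp)).mono ?_
  filter_upwards [eventually_gt_atTop 0] with n hn
  refine Eventually.of_forall fun ω hω => ?_
  rw [hint] at hω
  rw [empirical_eq_ofReal_average hn hA, ← ofReal_measureReal (measure_ne_top _ _),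
    ← ENNReal.ofReal_mul' hp.le]
  refine ENNReal.ofReal_le_ofReal ?_
  linarith [(abs_lt.1 hω).1]

end

/-- The four factors `1 - η` pay for the tilting, the regulariser, the posterior mass off `N` and
the sampling error. -/
lemma ofReal_pow_le_predictive {n : ℕ} {x : ℕ → ℝ} {t : ℝ} {H : ℝ → Measure ℝ} {π : Measure ℝ}
    {Pstar : Measure ℝ} [SFinite π] (h : Admissible n x t H) (hH : Measurable H)
    (hπ : ∀ᵐ m ∂π, m ∈ Set.Ioo (0 : ℝ) 1) {N : Set ℝ} (hNm : MeasurableSet N) {η : ℝ}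
    (hη1 : η ≤ 1)
    (hN : ∀ m ∈ N, m ∈ Set.Ioo (0 : ℝ) 1 → |tilt n x t H m| ≤ η)
    (hNpost : ENNReal.ofReal (1 - η) ≤ posterior n x t H π N) (ht : t ≤ η * n)
    {A : Set ℝ} (hA : MeasurableSet A)
    (hemp : ENNReal.ofReal (1 - η) * Pstar A ≤ empirical n x A) :
    ENNReal.ofReal ((1 - η) ^ 4) * Pstar A ≤ predictive n x t H π A := by
  refine le_trans ?_ (h.le_predictive hH hπ hNm (fun m hm hm1 _ => hN m hm hm1) hA)
  have h0 : 0 ≤ 1 - η := sub_nonneg.2 hη1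
  have h1 : ENNReal.ofReal (1 - η) ≤ ENNReal.ofReal (Real.exp (-η)) :=
    ENNReal.ofReal_le_ofReal (by linarith [Real.add_one_le_exp (-η)])
  have h2 : ENNReal.ofReal (1 - η) ≤ ENNReal.ofReal (n / (n + t)) := by
    refine ENNReal.ofReal_le_ofReal ((le_div_iff₀ h.add_pos).2 ?_)
    have := mul_le_mul_of_nonneg_left ht h0
    nlinarith [mul_nonneg (sq_nonneg η) h.cast_pos.le]
  calc ENNReal.ofReal ((1 - η) ^ 4) * Pstar A
      = ENNReal.ofReal (1 - η) * (ENNReal.ofReal (1 - η) *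
        (ENNReal.ofReal (1 - η) * Pstar A)) * ENNReal.ofReal (1 - η) := by
        rw [ENNReal.ofReal_pow h0]; ring
    _ ≤ _ := by gcongr

end RETEL

/-! ### Assembly of the four conclusions -/

theorem mainTheorem3
    {Ω : Type*} [MeasurableSpace Ω] (P : Measure Ω) [IsProbabilityMeasure P]
    -- the data: i.i.d. from a non-degenerate distribution on `[0, 1]`
    (Pstar : Measure ℝ) [IsProbabilityMeasure Pstar]
    (X : ℕ → Ω → ℝ) (hXm : ∀ i, Measurable (X i))
    (hXindep : iIndepFun X P) (hXlaw : ∀ i, P.map (X i) = Pstar)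
    (hPstar : Pstar (Set.Icc 0 1)ᶜ = 0)
    (μstar : ℝ) (hmean : ∫ x, x ∂Pstar = μstar) (hμstar : μstar ∈ Set.Ioo (0 : ℝ) 1)
    (hvar : 0 < variance (fun x : ℝ => x) Pstar)
    -- the prior on `[0, 1]`
    (π : Measure ℝ) [IsProbabilityMeasure π] (hπ : π (Set.Icc 0 1)ᶜ = 0)
    (hπac : π ≪ volume)
    (hπpos : ∃ c : ℝ≥0∞, 0 < c ∧ ∃ U ∈ 𝓝 μstar, ∀ᵐ x : ℝ, x ∈ U → c ≤ π.rnDeriv volume x)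
    -- the regularisation weights and the regularising distributions
    (τ : ℕ → ℝ) (hτ0 : ∀ n, 0 ≤ τ n) (hτ : τ =o[atTop] fun n : ℕ => (n : ℝ))
    (H : ℝ → Measure ℝ) (hHm : Measurable H)
    (hHprob : ∀ m ∈ Set.Ioo (0 : ℝ) 1, IsProbabilityMeasure (H m))
    (hHsupp : ∀ m ∈ Set.Ioo (0 : ℝ) 1, H m (Set.Icc 0 1)ᶜ = 0)
    (hHconv : ∀ m ∈ Set.Ioo (0 : ℝ) 1, convexHull ℝ (H m).support = Set.Icc 0 1) :
    -- the pseudo-posterior is well defined with probability tending to one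
    Tendsto (fun n => P {ω | ¬ IsProbabilityMeasure
      (RETEL.posterior n (fun i => X i ω) (τ n) H π)}) atTop (𝓝 0) ∧
    -- concentration of the mean and of the tilting parameter
    (∀ ε : ℝ, 0 < ε → RETEL.TendstoZeroInProb P (fun n ω =>
      RETEL.posterior n (fun i => X i ω) (τ n) H π {m | ε < |m - μstar|})) ∧
    (∀ ε : ℝ, 0 < ε → RETEL.TendstoZeroInProb P (fun n ω =>
      RETEL.posterior n (fun i => X i ω) (τ n) H π
        {m | ε < |RETEL.tilt n (fun i => X i ω) (τ n) H m|})) ∧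
    -- consistency of the pseudo-predictive
    RETEL.TendstoZeroInProb P (fun n ω =>
      RETEL.wasserstein1 (RETEL.predictive n (fun i => X i ω) (τ n) H π) Pstar) := by
  open RETEL in
  have hπI := ae_mem_Ioo hπ hπac
  have hπμ : ∀ e > 0, π (Metric.ball μstar e) ≠ 0 := fun e he =>
    measure_ball_ne_zero_of_rnDeriv hπac hπpos he
  have hv : 0 < variance (fun x : ℝ => x) Pstar / 2 := by positivity
  have hmom := fun (δ : ℝ) (hδ : 0 < δ) => withHighProb_moments hXm hXindep hXlaw hPstar hmean hδ
    hvar hτ0 hτ hHprob hHsupp hHconv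
  have hpost : ∀ ε > 0, ∀ θ : ℝ≥0∞, 0 < θ → WithHighProb P fun n ω =>
      IsProbabilityMeasure (posterior n (fun i => X i ω) (τ n) H π) ∧
        posterior n (fun i => X i ω) (τ n) H π {m | ε < |m - μstar|} < θ := by
    intro ε hε θ hθ
    obtain ⟨δ, hδ, C, hC, r, hr, hbound⟩ := exists_posterior_le (H := H) hμstar hv hπI hπμ hε
    have hlim : Tendsto (fun n : ℕ => C * r ^ n) atTop (𝓝 0) := by
      simpa using ENNReal.Tendsto.const_mul (ENNReal.tendsto_pow_atTop_nhds_zero_of_lt_one hr)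
        (Or.inr hC)
    refine (hmom δ hδ).mono ?_
    filter_upwards [hlim.eventually_lt_const hθ] with n hn
    refine Eventually.of_forall fun ω ⟨h1, h2, h3, h4⟩ => ?_
    obtain ⟨h5, h6⟩ := hbound n _ _ h1 h2 h3 h4
    exact ⟨h5, h6.trans_lt hn⟩
  refine ⟨?_, fun ε hε => ?_, fun ε hε => ?_, ?_⟩
  · exact (hpost 1 one_pos 1 one_pos).mono
      (Eventually.of_forall fun n => Eventually.of_forall fun ω h => h.1)
  · exact tendstoZeroInProb_of_withHighProb fun θ hθ => (hpost ε hε θ hθ).mono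
      (Eventually.of_forall fun n => Eventually.of_forall fun ω h => h.2)
  · refine tendstoZeroInProb_of_withHighProb fun θ hθ => ?_
    obtain ⟨δ, hδ, htilt⟩ := exists_abs_tilt_le (H := H) (μ := μstar) hv hε
    refine ((hpost δ hδ θ hθ).and (hmom δ hδ)).mono
      (Eventually.of_forall fun n => Eventually.of_forall fun ω ⟨⟨_, h2⟩, h3, h4, h5, h6⟩ => ?_)
    -- Almost everywhere, a large tilt forces `m` away from `μstar`. Comparing the sets this way
    -- requires no measurability of the tilt.
    refine lt_of_le_of_lt (measure_mono_ae ?_) h2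
    filter_upwards [Admissible.ae_inner hπI] with m hm hmε
    by_contra hc
    exact absurd hmε (not_lt.2 (htilt n _ _ h3 h4 h5 h6 m hm.1 (not_lt.1 hc)))
  · refine tendstoZeroInProb_of_withHighProb fun θ hθ => ?_
    obtain ⟨d, hd, hdθ⟩ : ∃ d : ℝ, 0 < d ∧ ENNReal.ofReal d < θ := by
      obtain ⟨d, _, h1, h2⟩ := ENNReal.lt_iff_exists_real_btwn.1 hθ
      exact ⟨d, ENNReal.ofReal_pos.1 h1, h2⟩
    -- By Bernoulli's inequality `1 - (1 - η) ^ 4 ≤ 4η ≤ d / 2`; the mesh `1 / (K + 1)` takes the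
    -- other half of `d`.
    set η := min (d / 8) (1 / 2)
    have hη : 0 < η := by positivity
    have hη1 : η ≤ 1 := (min_le_right _ _).trans (by norm_num)
    obtain ⟨K, hK⟩ := exists_nat_one_div_lt (show 0 < d / 2 by positivity)
    obtain ⟨δ, hδ, htilt⟩ := exists_abs_tilt_le (H := H) (μ := μstar) hv hη
    -- Mesh `1 / (K + 1)` involves the `K + 2` cells of indices `0` to `K + 1`.
    have hcells := withHighProb_forall_finset (P := P) (Finset.range (K + 2)) fun k _ =>
      withHighProb_empirical hXm hXindep hXlaw hη (measurableSet_cell (K + 1) k)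
    refine (((hpost δ hδ _ (ENNReal.ofReal_pos.2 hη)).and
      (hmom (min δ η) (lt_min hδ hη))).and hcells).mono
      (Eventually.of_forall fun n => Eventually.of_forall
        fun ω ⟨⟨⟨hprob, h2⟩, h3, h4, h5, h6⟩, h7⟩ => ?_)
    have hNm : MeasurableSet {m : ℝ | δ < |m - μstar|} :=
      measurableSet_lt measurable_const (by fun_prop)
    have := h3.isProbabilityMeasure_predictive hHm hπI
    have hτδ : τ n ≤ δ * n := h6.trans (by gcongr; exact min_le_left _ _)
    have hτη : τ n ≤ η * n := h6.trans (by gcongr; exact min_le_right _ _)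
    have hN : ENNReal.ofReal (1 - η) ≤
        posterior n (fun i => X i ω) (τ n) H π {m : ℝ | δ < |m - μstar|}ᶜ := by
      rw [prob_compl_eq_one_sub hNm, ENNReal.ofReal_sub _ hη.le, ENNReal.ofReal_one]
      exact tsub_le_tsub_left h2.le 1
    have hθ1 : ENNReal.ofReal ((1 - η) ^ 4) ≤ 1 :=
      ENNReal.ofReal_le_one.2 (pow_le_one₀ (sub_nonneg.2 hη1) (by linarith))
    refine (wasserstein1_le_of_cells (h3.predictive_compl_Icc hHm hπI) hPstar K.succ_pos hθ1
      fun k hk => ofReal_pow_le_predictive h3 hHm hπI hNm.compl hη1 ?_ hN hτη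
        (measurableSet_cell _ k) (h7 k (Finset.mem_range.2 (by omega)))).trans_lt ?_
    · exact fun m hm hmI => htilt n _ _ h3 (h4.trans (min_le_left _ _)) h5 hτδ m hmI (not_lt.1 hm)
    · refine lt_of_le_of_lt ?_ hdθ
      rw [← ENNReal.ofReal_one, ← ENNReal.ofReal_sub _ (by positivity),
        ← ENNReal.ofReal_add (by positivity)
          (sub_nonneg.2 (pow_le_one₀ (sub_nonneg.2 hη1) (by linarith)))]
      refine ENNReal.ofReal_le_ofReal ?_
      have h8 := one_add_mul_le_pow (show -2 ≤ -η by linarith) 4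
      have h9 : η ≤ d / 8 := min_le_left _ _
      rw [← sub_eq_add_neg] at h8
      push_cast at h8 ⊢
      linarith
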